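/- **Definitions.** Let $X$ be a finite set with at least $3$ elements. A *tree of spheres* $\mathcal T$ marked by $X$ consists of: a finite tree $T$ whose leaves are the elements of $X$ and whose internal vertices all have valence at least $3$; for each internal vertex $v$, a topological sphere $\mathcal S_v$ with a projective structure (a Möbius class of homeomorphisms onto $\mathbb P^1(\mathbb C)$); and, for each internal vertex $v$, an injection $i_v:E_v\to\mathcal S_v$ of the set $E_v$ of edges at $v$. Put $X_v=i_v(E_v)$. A *cover* $\mathcal F:\mathcal T^Y\to\mathcal T^Z$ between trees of spheres marked by $Y$ and $Z$ consists of a map $F:T^Y\to T^Z$ sending leaves to leaves, internal vertices to internal vertices and edges to edges, and, for each internal vertex $v$ of $T^Y$ with image $w=F(v)$, a holomorphic ramified cover $f_v:\mathcal S_v\to\mathcal S_w$ such that $f_v$ restricts to a covering $\mathcal S_v\setminus Y_v\to\mathcal S_w\setminus Z_w$, such that $f_v\circ i_v=i_w\circ F$, and such that, for every edge $e$ between internal vertices $v,v'$, the local degrees of $f_v$ at $i_v(e)$ and of $f_{v'}$ at $i_{v'}(e)$ agree. Its *degree* is $\sum_{v\in F^{-1}(w)}\deg f_v$, for any internal vertex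 $w$ of $T^Z$. An *isomorphism* $\mathcal M$ of trees of spheres marked by $X$ is a cover of degree $1$ that is the identity on $X$; write $\mathcal T\sim\mathcal T'$ if one exists, and let $\overline{\mathbf{Mod}}_X$ be the set of isomorphism classes of trees of spheres marked by $X$. An isomorphism between covers $\mathcal F^1:\mathcal T^Y_1\to\mathcal T^Z_1$ and $\mathcal F^2:\mathcal T^Y_2\to\mathcal T^Z_2$ is a pair of isomorphisms $\mathcal M^Y:\mathcal T_1^Y\to\mathcal T_2^Y$, $\mathcal M^Z:\mathcal T^Z_1\to\mathcal T^Z_2$ with $\mathcal M^Z\circ\mathcal F^1=\mathcal F^2\circ\mathcal M^Y$ on vertices and on the spheres at the internal vertices. A *portrait* $\mathbf F=(F,\deg)$ of degree $d\ge2$ consists of maps $F:Y\to Z$ and $\deg:Y\to\mathbb N\setminus\{0\}$ between finite sets such that $\sum_{a\in Y}(\deg(a)-1)=2d-2$ and $\sum_{a\in F^{-1}(b)}\deg(a)=d$ for all $b\in Z$. A cover has portrait $\mathbf F$ if it restricts to $F$ on the leaves and, for each leaf $y\in Y$, its local degree at the attaching point of the edge of $y$ is $\deg(y)$. Let $\overline{\mathbf{Rev}}_{\mathbf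 F}$ be the set of all covers between trees of spheres with portrait $\mathbf F$, and $\overline{\mathbf{rev}}_{\mathbf F}$ the set of their isomorphism classes. **Theorem.** Let $Y,Z$ be finite sets with at least $3$ elements each and let $\mathbf F$ be a portrait with $F:Y\to Z$. 1. The map $\mathcal I$ that sends a cover $\mathcal T^Y\to\mathcal T^Z$ in $\overline{\mathbf{Rev}}_{\mathbf F}$ to the pair $(\mathcal T^Y,\mathcal T^Z)$ is injective. 2. The map $[I]:\overline{\mathbf{rev}}_{\mathbf F}\to\overline{\mathbf{Mod}}_Y\times\overline{\mathbf{Mod}}_Z$ that it induces on isomorphism classes is well defined and injective. 3. If two covers in $\overline{\mathbf{Rev}}_{\mathbf F}$ have isomorphic source trees, then they are isomorphic. Hence the first component $\mathbf I:\overline{\mathbf{rev}}_{\mathbf F}\to\overline{\mathbf{Mod}}_Y$ of $[I]$ is injective. -/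

import Mathlib

universe u u' v

namespace SphereTrees

/-! ### Spheres with a projective structure -/

/-- A projective structure on a topological sphere `S`: the set of its projective charts, i.e. of
its projective isomorphisms onto the Riemann sphere `ℙ¹(ℂ) = ℂ ∪ {∞}`. It is one full orbit of
homeomorphisms `S ≃ ℙ¹(ℂ)` under post-composition by Moebius transformations (the group
`GL₂(ℂ)` acts on `OnePoint ℂ` by Moebius transformations). -/
class ProjectiveStructure (S : Type v) [TopologicalSpace S] where
  charts : Set (S ≃ₜ OnePoint ℂ)
  nonempty : charts.Nonempty
  mem_iff : ∀ σ ∈ charts, ∀ τ : S ≃ₜ OnePoint ℂ,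
    τ ∈ charts ↔ ∃ g : GL (Fin 2) ℂ, ∀ s : S, τ s = g • σ s

section Maps

variable {S S' : Type v} [TopologicalSpace S] [TopologicalSpace S']

/-- The expression `τ ∘ f ∘ σ⁻¹ : ℂ → ℂ` of a map `f` between spheres in the charts `σ` and `τ`
(with the dummy value `0` where `τ ∘ f ∘ σ⁻¹` is infinite). -/
noncomputable def inCharts (σ : S ≃ₜ OnePoint ℂ) (τ : S' ≃ₜ OnePoint ℂ) (f : S → S') : ℂ → ℂ :=
  fun z => (τ (f (σ.symm (z : OnePoint ℂ)))).elim 0 id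

variable [ProjectiveStructure S] [ProjectiveStructure S']

/-- Holomorphic maps: continuous, and analytic in all charts wherever the expression in the charts
is finite. -/
def IsHolomorphic (f : S → S') : Prop :=
  Continuous f ∧
    ∀ σ ∈ ProjectiveStructure.charts (S := S), ∀ τ ∈ ProjectiveStructure.charts (S := S'),
      ∀ z : ℂ, τ (f (σ.symm (z : OnePoint ℂ))) ≠ OnePoint.infty →
        AnalyticAt ℂ (inCharts σ τ f) z

/-- Holomorphic ramified covers between (compact) spheres: the nonconstant holomorphic maps. -/
def IsRamifiedCover (f : S → S') : Prop :=
  IsHolomorphic f ∧ ∃ s t : S, f s ≠ f t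

/-- The local degree at `s` of a holomorphic ramified cover `f`: the order of vanishing at `0` of
`f` read in projective charts that are centred at `s` and at `f s`. All centred charts give the
same number, so that the set below is a singleton. -/
noncomputable def localDegree (f : S → S') (s : S) : ℕ :=
  sInf {n : ℕ | ∃ σ ∈ ProjectiveStructure.charts (S := S),
    ∃ τ ∈ ProjectiveStructure.charts (S := S'),
      σ s = ((0 : ℂ) : OnePoint ℂ) ∧ τ (f s) = ((0 : ℂ) : OnePoint ℂ) ∧
        n = analyticOrderNatAt (inCharts σ τ f) 0}

end Maps

/-! ### Trees of spheres -/

/-- A (projective, stable) tree of spheres marked by `X`. The vertices of its combinatorial tree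
are the elements of `X`, which are the leaves, and the internal vertices, which form the finite
set `IV`. In a simple graph the edges adjacent to a vertex correspond to its neighbours, so that
the injection `i_v : E_v → 𝒮_v` is the map `attach v` on the neighbours of `v`. -/
structure TreeOfSpheres (X : Type u) where
  IV : Type v
  finite_IV : Finite IV
  graph : SimpleGraph (X ⊕ IV)
  isTree : graph.IsTree
  leaf : ∀ x : X, (graph.neighborSet (Sum.inl x)).ncard = 1
  stable : ∀ w : IV, 3 ≤ (graph.neighborSet (Sum.inr w)).ncard
  Sphere : IV → Type v
  topology : ∀ w : IV, TopologicalSpace (Sphere w)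
  projective : ∀ w : IV, ProjectiveStructure (Sphere w)
  attach : ∀ w : IV, graph.neighborSet (Sum.inr w) → Sphere w
  attach_injective : ∀ w : IV, Function.Injective (attach w)

attribute [instance] TreeOfSpheres.topology TreeOfSpheres.projective

variable {Y : Type u} {Z : Type u'}

/-- A (holomorphic) cover between trees of spheres. The map of combinatorial trees is
`Sum.map leafMap vertMap`; it maps leaves to leaves, internal vertices to internal vertices and
edges to edges. -/
structure TreeCover (T : TreeOfSpheres.{u, v} Y) (T' : TreeOfSpheres.{u', v} Z) where
  leafMap : Y → Z
  vertMap : T.IV → T'.IV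
  map_adj : ∀ {a b : Y ⊕ T.IV}, T.graph.Adj a b →
    T'.graph.Adj (Sum.map leafMap vertMap a) (Sum.map leafMap vertMap b)
  sphereMap : ∀ w : T.IV, T.Sphere w → T'.Sphere (vertMap w)
  ramifiedCover : ∀ w : T.IV, IsRamifiedCover (sphereMap w)
  mapsTo : ∀ w : T.IV,
    Set.MapsTo (sphereMap w) (Set.range (T.attach w))ᶜ (Set.range (T'.attach (vertMap w)))ᶜ
  isCoveringMap : ∀ w : T.IV, IsCoveringMap (mapsTo w).restrict
  sphereMap_attach : ∀ (w : T.IV) (a : Y ⊕ T.IV) (h : T.graph.Adj (Sum.inr w) a),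
    sphereMap w (T.attach w ⟨a, h⟩) =
      T'.attach (vertMap w) ⟨Sum.map leafMap vertMap a, map_adj h⟩
  localDegree_eq : ∀ (w₁ w₂ : T.IV) (h : T.graph.Adj (Sum.inr w₁) (Sum.inr w₂)),
    localDegree (sphereMap w₁) (T.attach w₁ ⟨Sum.inr w₂, h⟩) =
      localDegree (sphereMap w₂) (T.attach w₂ ⟨Sum.inr w₁, h.symm⟩)

namespace TreeCover

variable {T : TreeOfSpheres.{u, v} Y} {T' : TreeOfSpheres.{u', v} Z}

/-- The map induced by a cover from the disjoint union of the spheres of the source to the disjoint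
union of the spheres of the target. -/
def total (C : TreeCover T T') : (Σ w : T.IV, T.Sphere w) → Σ w : T'.IV, T'.Sphere w :=
  fun p => ⟨C.vertMap p.1, C.sphereMap p.1 p.2⟩

/-- `C` has global degree `D`: every point of a sphere of the target has exactly `D` preimages in
the spheres of the source, counted with local degrees. Equivalently, for each internal vertex `w`
of the target, the degrees of the maps `f_v`, for `v` over `w`, add up to `D`. -/
def HasDegree (C : TreeCover T T') (D : ℕ) : Prop :=
  ∀ q : Σ w : T'.IV, T'.Sphere w,
    ∑ᶠ p ∈ C.total ⁻¹' {q}, localDegree (C.sphereMap p.1) p.2 = D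

end TreeCover

/-- Isomorphisms between trees of spheres marked by the same set: the covers of degree `1` that
restrict to the identity on the marking set. -/
def TreeCover.IsIso {T T' : TreeOfSpheres.{u, v} Y} (M : TreeCover T T') : Prop :=
  M.HasDegree 1 ∧ ∀ y : Y, M.leafMap y = y

/-- Isomorphic trees of spheres: `𝒯 ∼ 𝒯'`. -/
def TreeIso (T T' : TreeOfSpheres.{u, v} Y) : Prop :=
  ∃ M : TreeCover T T', M.IsIso

/-- The moduli space of trees of spheres marked by `Y`: the trees of spheres modulo `TreeIso`. -/
def ModBar (Y : Type u) : Type (max u (v + 1)) :=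
  Quot (TreeIso (Y := Y) : TreeOfSpheres.{u, v} Y → TreeOfSpheres.{u, v} Y → Prop)

/-! ### Portraits and covers with a given portrait -/

/-- A portrait `(F, deg)` of degree `d ≥ 2`. -/
structure Portrait (Y : Type u) (Z : Type u') [Fintype Y] [DecidableEq Z] (d : ℕ) where
  map : Y → Z
  deg : Y → ℕ
  two_le : 2 ≤ d
  deg_pos : ∀ a : Y, 0 < deg a
  sum_deg_sub_one : ∑ a : Y, ((deg a : ℤ) - 1) = 2 * (d : ℤ) - 2
  sum_fiber : ∀ b : Z, ∑ a : Y with map a = b, deg a = d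

variable [Fintype Y] [DecidableEq Z] {d : ℕ}

/-- A cover between trees of spheres has portrait `(F, deg)` if it restricts to `F` on the leaves
and if its local degree at the point where the edge of a leaf `y` is attached is `deg y`. -/
def TreeCover.HasPortrait {T : TreeOfSpheres.{u, v} Y} {T' : TreeOfSpheres.{u', v} Z}
    (C : TreeCover T T') (P : Portrait Y Z d) : Prop :=
  C.leafMap = P.map ∧
    ∀ (y : Y) (w : T.IV) (h : T.graph.Adj (Sum.inr w) (Sum.inl y)),
      localDegree (C.sphereMap w) (T.attach w ⟨Sum.inl y, h⟩) = P.deg y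

/-- The set of all covers between trees of spheres with portrait `P`. -/
structure RevBar (P : Portrait Y Z d) where
  source : TreeOfSpheres.{u, v} Y
  target : TreeOfSpheres.{u', v} Z
  cover : TreeCover source target
  hasPortrait : cover.HasPortrait P

/-- Isomorphic covers: there are isomorphisms `ℳʸ`, `ℳᶻ` between the sources and between the
targets such that `ℳᶻ ∘ ℱ₁ = ℱ₂ ∘ ℳʸ` on leaves, on internal vertices and on their spheres. -/
def CoverIso {P : Portrait Y Z d} (C₁ C₂ : RevBar.{u, u', v} P) : Prop :=
  ∃ (MY : TreeCover C₁.source C₂.source) (MZ : TreeCover C₁.target C₂.target),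
    MY.IsIso ∧ MZ.IsIso ∧
      MZ.leafMap ∘ C₁.cover.leafMap = C₂.cover.leafMap ∘ MY.leafMap ∧
      MZ.vertMap ∘ C₁.cover.vertMap = C₂.cover.vertMap ∘ MY.vertMap ∧
      MZ.total ∘ C₁.cover.total = C₂.cover.total ∘ MY.total

/-- Covers between trees of spheres with portrait `P`, modulo isomorphism. -/
def RevBarClass (P : Portrait Y Z d) : Type (max u u' (v + 1)) :=
  Quot (CoverIso (P := P) : RevBar.{u, u', v} P → RevBar.{u, u', v} P → Prop)

/-- The map `𝓘` that sends a cover `𝒯ʸ → 𝒯ᶻ` to the pair `(𝒯ʸ, 𝒯ᶻ)`. -/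
def endTrees (P : Portrait Y Z d) (C : RevBar.{u, u', v} P) :
    TreeOfSpheres.{u, v} Y × TreeOfSpheres.{u', v} Z :=
  (C.source, C.target)

/-- The map `[I]` induced by `𝓘` on isomorphism classes. -/
def endClasses (P : Portrait Y Z d) :
    RevBarClass.{u, u', v} P → ModBar.{u, v} Y × ModBar.{u', v} Z :=
  Quot.lift
    (fun C => (Quot.mk TreeIso (endTrees P C).1, Quot.mk TreeIso (endTrees P C).2))
    (by
      rintro C₁ C₂ ⟨MY, MZ, hY, hZ, -⟩
      exact Prod.ext (Quot.sound ⟨MY, hY⟩) (Quot.sound ⟨MZ, hZ⟩))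

/-- The map `𝐈`, the first component of `[I]`. -/
def sourceClass (P : Portrait Y Z d) (c : RevBarClass.{u, u', v} P) : ModBar.{u, v} Y :=
  (endClasses P c).1

end SphereTrees

namespace SphereTrees

open Filter Topology Bornology

/-! ### Moebius transformations and projective charts -/

/-! A cover is recovered from its source and its portrait, up to an isomorphism of the target. The
reason has a combinatorial and an analytic half.

Combinatorially, a cover is a harmonic map of trees whose edge weights are the local degrees: over
each edge of the target at the image of `v`, the weights of the edges at `v` have the same sum, the
degree of `v` (`TreeCover.HasPortrait.exists_harmonicMap`, by `IsRamifiedCover.sum_localDegree_eq`).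
Cut the source at an edge `va` and count, with degrees, how often the branch beyond `a` covers each
vertex of the target. Edges inside the branch contribute equally to both ends of a target edge, so
the count jumps only across the image of `va`, by the weight of `va`
(`HarmonicMap.exists_sum_degree_branch`). At the leaves of the target the count depends on the
portrait alone, and by stability there are leaves on both sides of the image edge. Hence the
portrait determines the weight and the set of leaves beyond the image edge
(`HarmonicMap.OnLeaves.branch_iff`). Branches tell apart the internal vertices of a stable tree, so
the vertex map is determined when the target is given (`HarmonicMap.OnLeaves.eq`), and its fibres
are determined in general (`HarmonicMap.OnLeaves.inr_eq_of_inr_eq`).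

Analytically, a rational map is determined by its zeros and poles with multiplicity and one more
value, since the quotient of two candidates is constant by Liouville
(`IsRamifiedCover.eq_of_fibres`). The fibres over attaching points consist of attaching points, with
the edge weights as multiplicities. Sending three attaching points of the target sphere to `0`, `∞`,
`1` therefore fixes the map in charts. For one target this gives equality
(`TreeCover.HasPortrait.eq`); for two targets the normalised charts compose to projective
isomorphisms (`TreeCover.HasPortrait.exists_treeEquiv`). Isomorphic sources are reduced to equal
ones by composition (`coverIso_of_treeIso`), once degree `1` covers are known to be invertible
(`TreeCover.IsIso.nonempty_treeEquiv`). -/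

/-- The finite value of a point of `ℂ ∪ {∞}`, with the dummy value `0` at `∞`. -/
noncomputable def finitePart (p : OnePoint ℂ) : ℂ := p.elim 0 id

@[simp] lemma finitePart_coe (z : ℂ) : finitePart (z : OnePoint ℂ) = z := rfl

@[simp] lemma finitePart_infty : finitePart (OnePoint.infty : OnePoint ℂ) = 0 := rfl

lemma coe_finitePart {p : OnePoint ℂ} (h : p ≠ OnePoint.infty) : (finitePart p : OnePoint ℂ) = p := by
  obtain ⟨z, rfl⟩ := OnePoint.ne_infty_iff_exists.1 h
  rfl

lemma tendsto_coe_cobounded :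
    Tendsto ((↑) : ℂ → OnePoint ℂ) (cobounded ℂ) (𝓝 OnePoint.infty) := by
  have h := OnePoint.tendsto_coe_infty (X := ℂ)
  rwa [coclosedCompact_eq_cocompact, ← Metric.cobounded_eq_cocompact] at h

/-- The affine map `z ↦ a z + b` as an element of `GL₂(ℂ)`. -/
noncomputable def affineGL (a b : ℂ) (ha : a ≠ 0) : GL (Fin 2) ℂ :=
  Matrix.GeneralLinearGroup.mkOfDetNeZero !![a, b; 0, 1] (by simpa [Matrix.det_fin_two] using ha)

/-- The inversion `z ↦ 1 / z` as an element of `GL₂(ℂ)`. -/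
noncomputable def inversionGL : GL (Fin 2) ℂ :=
  Matrix.GeneralLinearGroup.mkOfDetNeZero !![0, 1; 1, 0] (by simp [Matrix.det_fin_two])

lemma affineGL_smul_coe {a b : ℂ} (ha : a ≠ 0) (z : ℂ) :
    affineGL a b ha • (z : OnePoint ℂ) = ((a * z + b : ℂ) : OnePoint ℂ) := by
  simp [OnePoint.smul_some_eq_ite, affineGL, Matrix.GeneralLinearGroup.mkOfDetNeZero]

lemma affineGL_smul_infty {a b : ℂ} (ha : a ≠ 0) :
    affineGL a b ha • (OnePoint.infty : OnePoint ℂ) = OnePoint.infty := by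
  simp [OnePoint.smul_infty_eq_ite, affineGL, Matrix.GeneralLinearGroup.mkOfDetNeZero]

lemma inversionGL_smul_coe {z : ℂ} (hz : z ≠ 0) :
    inversionGL • (z : OnePoint ℂ) = ((z⁻¹ : ℂ) : OnePoint ℂ) := by
  simp [OnePoint.smul_some_eq_ite, inversionGL, Matrix.GeneralLinearGroup.mkOfDetNeZero, hz]

lemma inversionGL_smul_zero :
    inversionGL • ((0 : ℂ) : OnePoint ℂ) = OnePoint.infty := by
  simp [OnePoint.smul_some_eq_ite, inversionGL, Matrix.GeneralLinearGroup.mkOfDetNeZero]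

lemma inversionGL_smul_infty :
    inversionGL • (OnePoint.infty : OnePoint ℂ) = ((0 : ℂ) : OnePoint ℂ) := by
  simp [OnePoint.smul_infty_eq_ite, inversionGL, Matrix.GeneralLinearGroup.mkOfDetNeZero]

/-- The conventions `0⁻¹ = 0` and `finitePart ∞ = 0` match, so no exception is needed at `0` or `∞`.
-/
lemma finitePart_inversionGL_smul (p : OnePoint ℂ) :
    finitePart (inversionGL • p) = (finitePart p)⁻¹ := by
  cases p with
  | infty => simp [inversionGL_smul_infty]
  | coe z =>
    by_cases hz : z = 0
    · simp [hz, inversionGL_smul_zero]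
    · simp [inversionGL_smul_coe hz]

lemma inversionGL_smul_smul (p : OnePoint ℂ) : inversionGL • inversionGL • p = p := by
  cases p with
  | infty => simp [inversionGL_smul_infty, inversionGL_smul_zero]
  | coe z =>
    by_cases hz : z = 0
    · simp [hz, inversionGL_smul_zero, inversionGL_smul_infty]
    · simp [inversionGL_smul_coe hz, inversionGL_smul_coe (inv_ne_zero hz)]

lemma continuous_inversionGL_smul : Continuous fun p : OnePoint ℂ => inversionGL • p := by
  rw [continuous_iff_continuousAt]
  intro p
  cases p with
  | infty =>
    rw [OnePoint.continuousAt_infty', inversionGL_smul_infty, coclosedCompact_eq_cocompact,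
      ← Metric.cobounded_eq_cocompact]
    have h : Tendsto (fun z : ℂ => ((z⁻¹ : ℂ) : OnePoint ℂ)) (cobounded ℂ)
        (𝓝 ((0 : ℂ) : OnePoint ℂ)) :=
      (OnePoint.continuous_coe.tendsto 0).comp tendsto_inv₀_cobounded
    refine h.congr' ?_
    filter_upwards [eventually_ne_cobounded (0 : ℂ)] with z hz
    simp [inversionGL_smul_coe hz]
  | coe k =>
    rw [OnePoint.continuousAt_coe]
    by_cases hk : k = 0
    · subst hk
      rw [continuousAt_iff_punctured_nhds]
      simp only [Function.comp_apply, inversionGL_smul_zero]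
      refine (tendsto_coe_cobounded.comp tendsto_inv₀_nhdsNE_zero).congr' ?_
      filter_upwards [self_mem_nhdsWithin] with z hz
      simp [inversionGL_smul_coe hz]
    · have h : ContinuousAt (fun z : ℂ => ((z⁻¹ : ℂ) : OnePoint ℂ)) k :=
        OnePoint.continuous_coe.continuousAt.comp (continuousAt_inv₀ hk)
      refine h.congr ?_
      filter_upwards [eventually_ne_nhds hk] with z hz
      simp [inversionGL_smul_coe hz]

/-- The inversion as a homeomorphism of the Riemann sphere. -/
noncomputable def inversionHomeo : OnePoint ℂ ≃ₜ OnePoint ℂ where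
  toFun p := inversionGL • p
  invFun p := inversionGL • p
  left_inv := inversionGL_smul_smul
  right_inv := inversionGL_smul_smul
  continuous_toFun := continuous_inversionGL_smul
  continuous_invFun := continuous_inversionGL_smul

/-- Affine maps as homeomorphisms of the Riemann sphere. -/
noncomputable def affineHomeo (a b : ℂ) (ha : a ≠ 0) : OnePoint ℂ ≃ₜ OnePoint ℂ :=
  (((Homeomorph.mulLeft₀ a ha).trans (Homeomorph.addRight b))).onePointCongr

@[simp] lemma inversionHomeo_apply (p : OnePoint ℂ) : inversionHomeo p = inversionGL • p := rfl

@[simp] lemma affineHomeo_coe {a b : ℂ} (ha : a ≠ 0) (z : ℂ) :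
    affineHomeo a b ha (z : OnePoint ℂ) = ((a * z + b : ℂ) : OnePoint ℂ) := rfl

@[simp] lemma affineHomeo_infty {a b : ℂ} (ha : a ≠ 0) :
    affineHomeo a b ha OnePoint.infty = OnePoint.infty := rfl

lemma affineHomeo_apply {a b : ℂ} (ha : a ≠ 0) (p : OnePoint ℂ) :
    affineHomeo a b ha p = affineGL a b ha • p := by
  cases p with
  | infty => simp [affineGL_smul_infty]
  | coe z => simp [affineGL_smul_coe]

lemma inCharts_apply {S S' : Type v} [TopologicalSpace S] [TopologicalSpace S']
    (σ : S ≃ₜ OnePoint ℂ) (τ : S' ≃ₜ OnePoint ℂ) (f : S → S') (z : ℂ) :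
    inCharts σ τ f z = finitePart (τ (f (σ.symm (z : OnePoint ℂ)))) := rfl

/-! ### Projective charts: normalisation and change of chart -/

section Charts

variable {S : Type v} [TopologicalSpace S] [ProjectiveStructure S]

/-- The set of projective charts of a sphere. -/
abbrev charts (S : Type v) [TopologicalSpace S] [ProjectiveStructure S] : Set (S ≃ₜ OnePoint ℂ) :=
  ProjectiveStructure.charts

lemma charts_trans_mem {σ : S ≃ₜ OnePoint ℂ} (hσ : σ ∈ charts S) {φ : OnePoint ℂ ≃ₜ OnePoint ℂ}
    {g : GL (Fin 2) ℂ} (hφ : ∀ p, φ p = g • p) : σ.trans φ ∈ charts S :=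
  (ProjectiveStructure.mem_iff σ hσ _).2 ⟨g, fun s => hφ (σ s)⟩

lemma charts_trans_inversion {σ : S ≃ₜ OnePoint ℂ} (hσ : σ ∈ charts S) :
    σ.trans inversionHomeo ∈ charts S :=
  charts_trans_mem hσ fun _ => rfl

lemma charts_trans_affine {σ : S ≃ₜ OnePoint ℂ} (hσ : σ ∈ charts S) {a : ℂ} (ha : a ≠ 0) (b : ℂ) :
    σ.trans (affineHomeo a b ha) ∈ charts S :=
  charts_trans_mem hσ fun p => affineHomeo_apply ha p

lemma exists_chart_infty (p : S) : ∃ σ ∈ charts S, σ p = OnePoint.infty := by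
  obtain ⟨σ, hσ⟩ := ProjectiveStructure.nonempty (S := S)
  by_cases h : σ p = OnePoint.infty
  · exact ⟨σ, hσ, h⟩
  · obtain ⟨z, hz⟩ := OnePoint.ne_infty_iff_exists.1 h
    refine ⟨_, charts_trans_inversion (charts_trans_affine hσ one_ne_zero (-z)), ?_⟩
    simp [← hz, inversionGL_smul_zero]

lemma exists_chart_zero_infty {p q : S} (h : p ≠ q) :
    ∃ σ ∈ charts S, σ p = ((0 : ℂ) : OnePoint ℂ) ∧ σ q = OnePoint.infty := by
  obtain ⟨σ, hσ, hq⟩ := exists_chart_infty q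
  have hp : σ p ≠ OnePoint.infty := fun h' => h (σ.injective (h'.trans hq.symm))
  obtain ⟨z, hz⟩ := OnePoint.ne_infty_iff_exists.1 hp
  exact ⟨_, charts_trans_affine hσ one_ne_zero (-z), by simp [← hz], by simp [hq]⟩

lemma exists_chart_zero_infty_one {p q r : S} (hpq : p ≠ q) (hpr : p ≠ r) (hqr : q ≠ r) :
    ∃ σ ∈ charts S, σ p = ((0 : ℂ) : OnePoint ℂ) ∧ σ q = OnePoint.infty ∧
      σ r = ((1 : ℂ) : OnePoint ℂ) := by
  obtain ⟨σ, hσ, hp, hq⟩ := exists_chart_zero_infty hpq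
  have hr : σ r ≠ OnePoint.infty := fun h' => hqr (σ.injective (hq.trans h'.symm))
  obtain ⟨z, hz⟩ := OnePoint.ne_infty_iff_exists.1 hr
  have hz0 : z ≠ 0 := by
    rintro rfl
    exact hpr (σ.injective (hp.trans hz))
  refine ⟨_, charts_trans_affine hσ (inv_ne_zero hz0) 0, by simp [hp], by simp [hq], ?_⟩
  simp [← hz, hz0]

lemma exists_chart_zero (p : S) : ∃ σ ∈ charts S, σ p = ((0 : ℂ) : OnePoint ℂ) := by
  obtain ⟨σ, hσ, hp⟩ := exists_chart_infty p
  exact ⟨_, charts_trans_inversion hσ, by simp [hp, inversionGL_smul_infty]⟩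

variable (S) in
lemma compactSpace_of_projectiveStructure : CompactSpace S :=
  (ProjectiveStructure.nonempty (S := S)).some.symm.compactSpace

variable (S) in
lemma t2Space_of_projectiveStructure : T2Space S :=
  (ProjectiveStructure.nonempty (S := S)).some.symm.t2Space

variable (S) in
lemma connectedSpace_of_projectiveStructure : ConnectedSpace S :=
  (ProjectiveStructure.nonempty (S := S)).some.symm.surjective.connectedSpace
    (ProjectiveStructure.nonempty (S := S)).some.symm.continuous

variable (S) in
lemma infinite_of_projectiveStructure : Infinite S :=
  Infinite.of_injective _ (ProjectiveStructure.nonempty (S := S)).some.symm.injective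

/-- The change of charts is analytic, with non-vanishing derivative, wherever it is finite. -/
lemma chart_change {σ σ' : S ≃ₜ OnePoint ℂ} (hσ : σ ∈ charts S) (hσ' : σ' ∈ charts S) {z : ℂ}
    (hz : σ' (σ.symm (z : OnePoint ℂ)) ≠ OnePoint.infty) :
    AnalyticAt ℂ (inCharts σ σ' id) z ∧ deriv (inCharts σ σ' id) z ≠ 0 := by
  obtain ⟨g, hg⟩ := (ProjectiveStructure.mem_iff σ hσ σ').1 hσ'
  have key : ∀ w : ℂ, inCharts σ σ' id w = finitePart (g • (w : OnePoint ℂ)) := by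
    intro w
    simp [inCharts_apply, hg]
  rw [hg, Homeomorph.apply_symm_apply, OnePoint.smul_some_eq_ite] at hz
  have hd : g 1 0 * z + g 1 1 ≠ 0 := by
    intro h
    simp [h] at hz
  have hev : inCharts σ σ' id =ᶠ[𝓝 z]
      fun w => (g 0 0 * w + g 0 1) / (g 1 0 * w + g 1 1) := by
    have hc : ContinuousAt (fun w : ℂ => g 1 0 * w + g 1 1) z := by fun_prop
    filter_upwards [hc.eventually_ne hd] with w hw
    rw [key, OnePoint.smul_some_eq_ite, if_neg hw]
    exact finitePart_coe _
  refine ⟨AnalyticAt.congr ?_ hev.symm, ?_⟩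
  · exact AnalyticAt.fun_div (by fun_prop) (by fun_prop) hd
  · have h1 : HasDerivAt (fun w : ℂ => g 0 0 * w + g 0 1) (g 0 0) z := by
      simpa using ((hasDerivAt_id z).const_mul (g 0 0)).add_const (g 0 1)
    have h2 : HasDerivAt (fun w : ℂ => g 1 0 * w + g 1 1) (g 1 0) z := by
      simpa using ((hasDerivAt_id z).const_mul (g 1 0)).add_const (g 1 1)
    have hdet := g.det_ne_zero
    rw [Matrix.det_fin_two] at hdet
    rw [hev.deriv_eq, (h1.fun_div h2 hd).deriv]
    -- The numerator of the derivative of a Moebius map is its determinant.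
    refine div_ne_zero ?_ (pow_ne_zero 2 hd)
    intro h
    apply hdet
    linear_combination h

end Charts

end SphereTrees

namespace SphereTrees

open Filter Topology Bornology

/-! ### Local degrees as orders of meromorphic functions -/

section LocalDegree

variable {S S' : Type v} [TopologicalSpace S] [TopologicalSpace S']

lemma nhds_symm_coe (σ : S ≃ₜ OnePoint ℂ) (z : ℂ) :
    𝓝 (σ.symm (z : OnePoint ℂ)) = map (fun w : ℂ => σ.symm (w : OnePoint ℂ)) (𝓝 z) := by
  rw [← σ.symm.map_nhds_eq, OnePoint.nhds_coe_eq, Filter.map_map]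
  rfl

lemma continuous_symm_coe (σ : S ≃ₜ OnePoint ℂ) :
    Continuous fun w : ℂ => σ.symm (w : OnePoint ℂ) :=
  σ.symm.continuous.comp OnePoint.continuous_coe

lemma eventually_chart_ne_infty {σ : S ≃ₜ OnePoint ℂ} {τ : S' ≃ₜ OnePoint ℂ} {f : S → S'}
    (hf : Continuous f) {z : ℂ} (hz : τ (f (σ.symm (z : OnePoint ℂ))) ≠ OnePoint.infty) :
    ∀ᶠ w : ℂ in 𝓝 z, τ (f (σ.symm (w : OnePoint ℂ))) ≠ OnePoint.infty :=
  (τ.continuous.comp (hf.comp (continuous_symm_coe σ))).continuousAt.eventually_ne hz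

lemma inCharts_trans_inversion (σ : S ≃ₜ OnePoint ℂ) (τ : S' ≃ₜ OnePoint ℂ) (f : S → S') :
    inCharts σ (τ.trans inversionHomeo) f = (inCharts σ τ f)⁻¹ := by
  ext z
  simp [inCharts_apply, finitePart_inversionGL_smul]

variable [ProjectiveStructure S] [ProjectiveStructure S']

/-- Identity theorem: the points near which `f` is constantly `q` form a clopen set, so on a
connected sphere `f` would be constant. -/
lemma IsRamifiedCover.not_eventually_eq {f : S → S'} (hf : IsRamifiedCover f) (s : S) (q : S') :
    ¬ ∀ᶠ t in 𝓝 s, f t = q := by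
  intro hs
  have := t2Space_of_projectiveStructure S'
  have := connectedSpace_of_projectiveStructure S
  set U : Set S := {s | ∀ᶠ t in 𝓝 s, f t = q} with hU
  have hUo : IsOpen U := isOpen_setOfPred_eventually_nhds
  have hUc : IsClosed U := by
    rw [← closure_subset_iff_isClosed]
    intro s hs
    have hsub : U ⊆ {t | f t = q} := fun t ht => ht.self_of_nhds
    have hfs : f s = q :=
      closure_minimal hsub (isClosed_eq hf.1.1 continuous_const) hs
    obtain ⟨σ, hσ, hσs⟩ := exists_chart_zero s
    obtain ⟨τ, hτ, hτq⟩ := exists_chart_zero q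
    have hs' : σ.symm ((0 : ℂ) : OnePoint ℂ) = s := by rw [← hσs, σ.symm_apply_apply]
    have h0 : τ (f (σ.symm ((0 : ℂ) : OnePoint ℂ))) ≠ OnePoint.infty := by
      rw [hs', hfs, hτq]
      exact OnePoint.coe_ne_infty 0
    have hfin := eventually_chart_ne_infty hf.1.1 h0
    have hval : ∀ w : ℂ, f (σ.symm (w : OnePoint ℂ)) = q → inCharts σ τ f w = 0 := by
      intro w hw
      rw [inCharts_apply, hw, hτq, finitePart_coe]
    rcases (hf.1.2 σ hσ τ hτ 0 h0).eventually_eq_zero_or_eventually_ne_zero with h | h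
    · rw [hU, Set.mem_ofPred_eq, ← hs', nhds_symm_coe, eventually_map]
      filter_upwards [h, hfin] with w hw hw'
      apply τ.injective
      rw [hτq, ← coe_finitePart hw', ← inCharts_apply, hw]
    -- If the zero at `0` were isolated, a nearby point of `U` would have a neighbourhood on which
    -- the expression both vanishes and is nonzero off `0`; that neighbourhood would be a single
    -- point.
    · exfalso
      rw [eventually_nhdsWithin_iff] at h
      have hfreq : ∃ᶠ w : ℂ in 𝓝 (0 : ℂ), σ.symm (w : OnePoint ℂ) ∈ U := by
        have := mem_closure_iff_frequently.1 hs
        rwa [← hs', nhds_symm_coe, frequently_map] at this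
      obtain ⟨w, hwU, hw⟩ := (hfreq.and_eventually h.eventually_nhds).exists
      rw [hU, Set.mem_ofPred_eq, nhds_symm_coe, eventually_map] at hwU
      have hw0 : ∀ᶠ w' in 𝓝 w, w' = 0 := by
        filter_upwards [hwU, hw] with w' h1 h2
        by_contra h3
        exact h2 h3 (hval w' h1)
      have hww := hw0.self_of_nhds
      have : ∀ᶠ w' in 𝓝[≠] w, False := by
        rw [eventually_nhdsWithin_iff]
        filter_upwards [hw0] with w' h1 h2
        exact h2 (h1.trans hww.symm)
      exact this.exists.elim fun _ h => h
  have huniv : U = Set.univ := IsClopen.eq_univ ⟨hUc, hUo⟩ ⟨s, hs⟩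
  obtain ⟨a, b, hab⟩ := hf.2
  have key : ∀ a, f a = q := fun a => by
    have : a ∈ U := huniv ▸ Set.mem_univ a
    exact this.self_of_nhds
  exact hab ((key a).trans (key b).symm)

lemma IsRamifiedCover.analyticOrderAt_ne_top {f : S → S'} (hf : IsRamifiedCover f)
    {σ : S ≃ₜ OnePoint ℂ} {τ : S' ≃ₜ OnePoint ℂ} {z : ℂ}
    (hz : τ (f (σ.symm (z : OnePoint ℂ))) = ((0 : ℂ) : OnePoint ℂ)) :
    analyticOrderAt (inCharts σ τ f) z ≠ ⊤ := by
  intro h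
  rw [analyticOrderAt_eq_top] at h
  apply hf.not_eventually_eq (σ.symm (z : OnePoint ℂ)) (f (σ.symm (z : OnePoint ℂ)))
  rw [nhds_symm_coe, eventually_map]
  have h0 : τ (f (σ.symm (z : OnePoint ℂ))) ≠ OnePoint.infty := by
    rw [hz]; exact OnePoint.coe_ne_infty 0
  filter_upwards [h, eventually_chart_ne_infty hf.1.1 h0] with w hw hw'
  apply τ.injective
  rw [hz, ← coe_finitePart hw', ← inCharts_apply, hw]

/-- Near the point the two expressions of `f` differ by chart changes on both sides; these have
nonzero derivative, and the outer one has order `1`, so neither affects the order. -/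
lemma analyticOrderAt_inCharts_eq {f : S → S'} (hf : IsHolomorphic f)
    {σ σ' : S ≃ₜ OnePoint ℂ} {τ τ' : S' ≃ₜ OnePoint ℂ} (hσ : σ ∈ charts S) (hσ' : σ' ∈ charts S)
    (hτ : τ ∈ charts S') (hτ' : τ' ∈ charts S') {z z' : ℂ}
    (hzz : σ.symm (z : OnePoint ℂ) = σ'.symm (z' : OnePoint ℂ))
    (hz : τ (f (σ.symm (z : OnePoint ℂ))) = ((0 : ℂ) : OnePoint ℂ))
    (hz' : τ' (f (σ'.symm (z' : OnePoint ℂ))) = ((0 : ℂ) : OnePoint ℂ)) :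
    analyticOrderAt (inCharts σ τ f) z = analyticOrderAt (inCharts σ' τ' f) z' := by
  have hAz : σ' (σ.symm (z : OnePoint ℂ)) = (z' : OnePoint ℂ) := by simp [hzz]
  have hAfin : σ' (id (σ.symm (z : OnePoint ℂ))) ≠ OnePoint.infty := by
    rw [id, hAz]; exact OnePoint.coe_ne_infty _
  obtain ⟨hA, hA'⟩ := chart_change hσ hσ' (z := z) hAfin
  have hfs : f (σ'.symm (z' : OnePoint ℂ)) = τ'.symm ((0 : ℂ) : OnePoint ℂ) := by simp [← hz']
  have hTz : τ (τ'.symm ((0 : ℂ) : OnePoint ℂ)) = ((0 : ℂ) : OnePoint ℂ) := by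
    rw [← hfs, ← hzz, hz]
  obtain ⟨hT, hT'⟩ := chart_change hτ' hτ (z := 0) (by rw [hTz]; exact OnePoint.coe_ne_infty _)
  set A := inCharts σ σ' id
  set T := inCharts τ' τ id
  set h := inCharts σ' τ' f
  have hAz' : A z = z' := by
    change finitePart (σ' (σ.symm (z : OnePoint ℂ))) = z'
    rw [hAz, finitePart_coe]
  have hT0 : T 0 = 0 := by
    change finitePart (τ (τ'.symm ((0 : ℂ) : OnePoint ℂ))) = 0
    rw [hTz, finitePart_coe]
  have hfin' : τ' (f (σ.symm (z : OnePoint ℂ))) ≠ OnePoint.infty := by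
    rw [hzz, hz']; exact OnePoint.coe_ne_infty _
  have hh : AnalyticAt ℂ h z' := hf.2 σ' hσ' τ' hτ' z' (by rw [← hzz]; exact hfin')
  have hh0 : h z' = 0 := by
    change finitePart (τ' (f (σ'.symm (z' : OnePoint ℂ)))) = 0
    rw [hz', finitePart_coe]
  have hev : inCharts σ τ f =ᶠ[𝓝 z] T ∘ (h ∘ A) := by
    filter_upwards [eventually_chart_ne_infty continuous_id hAfin,
      eventually_chart_ne_infty hf.1 hfin'] with w hw hw'
    have e1 : σ'.symm (A w : OnePoint ℂ) = σ.symm (w : OnePoint ℂ) := by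
      change σ'.symm (finitePart (σ' (σ.symm (w : OnePoint ℂ))) : OnePoint ℂ) = _
      rw [coe_finitePart (by exact hw), σ'.symm_apply_apply]
    have e2 : h (A w) = finitePart (τ' (f (σ.symm (w : OnePoint ℂ)))) := by
      change finitePart (τ' (f (σ'.symm (A w : OnePoint ℂ)))) = _
      rw [e1]
    have e3 : τ'.symm (h (A w) : OnePoint ℂ) = f (σ.symm (w : OnePoint ℂ)) := by
      rw [e2, coe_finitePart hw', τ'.symm_apply_apply]
    change finitePart _ = finitePart (τ (τ'.symm (h (A w) : OnePoint ℂ)))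
    rw [e3]
  have hhA : AnalyticAt ℂ (h ∘ A) z := AnalyticAt.comp (by rwa [hAz']) hA
  have hhA0 : (h ∘ A) z = 0 := by simp [hAz', hh0]
  have hT1 : analyticOrderAt T 0 = 1 := hT.analyticOrderAt_eq_one_of_zero_deriv_ne_zero hT0 hT'
  rw [analyticOrderAt_congr hev, AnalyticAt.analyticOrderAt_comp (by rwa [hhA0]) hhA, hhA0, hT1,
    one_mul]
  simp only [sub_zero]
  rw [analyticOrderAt_comp_of_deriv_ne_zero hA hA', hAz']

/-- The local degree can be computed in any charts in which the image point is `0`. -/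
lemma localDegree_eq_analyticOrderNatAt {f : S → S'} (hf : IsHolomorphic f)
    {σ : S ≃ₜ OnePoint ℂ} {τ : S' ≃ₜ OnePoint ℂ} (hσ : σ ∈ charts S) (hτ : τ ∈ charts S') {z : ℂ}
    (hz : τ (f (σ.symm (z : OnePoint ℂ))) = ((0 : ℂ) : OnePoint ℂ)) :
    localDegree f (σ.symm (z : OnePoint ℂ)) = analyticOrderNatAt (inCharts σ τ f) z := by
  have hset : {n : ℕ | ∃ σ₁ ∈ charts S, ∃ τ₁ ∈ charts S',
      σ₁ (σ.symm (z : OnePoint ℂ)) = ((0 : ℂ) : OnePoint ℂ) ∧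
      τ₁ (f (σ.symm (z : OnePoint ℂ))) = ((0 : ℂ) : OnePoint ℂ) ∧
        n = analyticOrderNatAt (inCharts σ₁ τ₁ f) 0} = {analyticOrderNatAt (inCharts σ τ f) z} := by
    have key : ∀ σ₁ ∈ charts S, ∀ τ₁ ∈ charts S',
        σ₁ (σ.symm (z : OnePoint ℂ)) = ((0 : ℂ) : OnePoint ℂ) →
        τ₁ (f (σ.symm (z : OnePoint ℂ))) = ((0 : ℂ) : OnePoint ℂ) →
        analyticOrderNatAt (inCharts σ₁ τ₁ f) 0 = analyticOrderNatAt (inCharts σ τ f) z := by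
      intro σ₁ h1 τ₁ h2 h3 h4
      have e : σ.symm (z : OnePoint ℂ) = σ₁.symm ((0 : ℂ) : OnePoint ℂ) := by
        rw [← h3, σ₁.symm_apply_apply]
      rw [analyticOrderNatAt, analyticOrderNatAt,
        analyticOrderAt_inCharts_eq hf hσ h1 hτ h2 e hz (by rwa [← e])]
    ext n
    simp only [Set.mem_ofPred_eq, Set.mem_singleton_iff]
    constructor
    · rintro ⟨σ₁, h1, τ₁, h2, h3, h4, rfl⟩
      exact key σ₁ h1 τ₁ h2 h3 h4
    · rintro rfl
      obtain ⟨σ₁, h1, h3⟩ := exists_chart_zero (σ.symm (z : OnePoint ℂ))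
      exact ⟨σ₁, h1, τ, hτ, h3, hz, (key σ₁ h1 τ hτ h3 hz).symm⟩
  change sInf _ = _
  rw [hset, csInf_singleton]

lemma IsRamifiedCover.natCast_localDegree {f : S → S'} (hf : IsRamifiedCover f)
    {σ : S ≃ₜ OnePoint ℂ} {τ : S' ≃ₜ OnePoint ℂ} (hσ : σ ∈ charts S) (hτ : τ ∈ charts S') {z : ℂ}
    (hz : τ (f (σ.symm (z : OnePoint ℂ))) = ((0 : ℂ) : OnePoint ℂ)) :
    (localDegree f (σ.symm (z : OnePoint ℂ)) : ℕ∞) = analyticOrderAt (inCharts σ τ f) z := by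
  rw [localDegree_eq_analyticOrderNatAt hf.1 hσ hτ hz,
    Nat.cast_analyticOrderNatAt (hf.analyticOrderAt_ne_top hz)]

lemma IsRamifiedCover.localDegree_pos {f : S → S'} (hf : IsRamifiedCover f) (s : S) :
    0 < localDegree f s := by
  obtain ⟨σ, hσ, hs⟩ := exists_chart_zero s
  obtain ⟨τ, hτ, hs'⟩ := exists_chart_zero (f s)
  have e : s = σ.symm ((0 : ℂ) : OnePoint ℂ) := by rw [← hs, σ.symm_apply_apply]
  have hz : τ (f (σ.symm ((0 : ℂ) : OnePoint ℂ))) = ((0 : ℂ) : OnePoint ℂ) := by rwa [← e]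
  have h1 := hf.natCast_localDegree hσ hτ hz
  rw [← e] at h1
  have h2 : AnalyticAt ℂ (inCharts σ τ f) 0 :=
    hf.1.2 σ hσ τ hτ 0 (by rw [hz]; exact OnePoint.coe_ne_infty _)
  have h3 : analyticOrderAt (inCharts σ τ f) 0 ≠ 0 := by
    rw [h2.analyticOrderAt_ne_zero, inCharts_apply, hz, finitePart_coe]
  rw [← h1] at h3
  exact Nat.pos_of_ne_zero (by exact_mod_cast h3)

/-- At a pole, the inverse of the expression is the expression in the inverted target chart, which
is analytic there. -/
lemma IsRamifiedCover.meromorphicAt {f : S → S'} (hf : IsRamifiedCover f)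
    {σ : S ≃ₜ OnePoint ℂ} {τ : S' ≃ₜ OnePoint ℂ} (hσ : σ ∈ charts S) (hτ : τ ∈ charts S') (z : ℂ) :
    MeromorphicAt (inCharts σ τ f) z := by
  by_cases hz : τ (f (σ.symm (z : OnePoint ℂ))) = OnePoint.infty
  · have h := hf.1.2 σ hσ _ (charts_trans_inversion hτ) z (by simp [hz, inversionGL_smul_infty])
    rw [inCharts_trans_inversion] at h
    simpa using h.meromorphicAt.inv
  · exact (hf.1.2 σ hσ τ hτ z hz).meromorphicAt

lemma IsRamifiedCover.meromorphicOrderAt_of_zero {f : S → S'} (hf : IsRamifiedCover f)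
    {σ : S ≃ₜ OnePoint ℂ} {τ : S' ≃ₜ OnePoint ℂ} (hσ : σ ∈ charts S) (hτ : τ ∈ charts S') {z : ℂ}
    (hz : τ (f (σ.symm (z : OnePoint ℂ))) = ((0 : ℂ) : OnePoint ℂ)) :
    meromorphicOrderAt (inCharts σ τ f) z = ((localDegree f (σ.symm (z : OnePoint ℂ)) : ℤ)) := by
  rw [(hf.1.2 σ hσ τ hτ z (by rw [hz]; exact OnePoint.coe_ne_infty _)).meromorphicOrderAt_eq,
    ← hf.natCast_localDegree hσ hτ hz]
  rfl

lemma IsRamifiedCover.meromorphicOrderAt_of_infty {f : S → S'} (hf : IsRamifiedCover f)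
    {σ : S ≃ₜ OnePoint ℂ} {τ : S' ≃ₜ OnePoint ℂ} (hσ : σ ∈ charts S) (hτ : τ ∈ charts S') {z : ℂ}
    (hz : τ (f (σ.symm (z : OnePoint ℂ))) = OnePoint.infty) :
    meromorphicOrderAt (inCharts σ τ f) z = ((-localDegree f (σ.symm (z : OnePoint ℂ)) : ℤ)) := by
  have h := hf.meromorphicOrderAt_of_zero hσ (charts_trans_inversion hτ) (z := z)
    (by simp [hz, inversionGL_smul_infty])
  rw [inCharts_trans_inversion, meromorphicOrderAt_inv] at h
  rw [← neg_neg (meromorphicOrderAt (inCharts σ τ f) z), h]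
  rfl

lemma IsRamifiedCover.meromorphicOrderAt_of_ne {f : S → S'} (hf : IsRamifiedCover f)
    {σ : S ≃ₜ OnePoint ℂ} {τ : S' ≃ₜ OnePoint ℂ} (hσ : σ ∈ charts S) (hτ : τ ∈ charts S') {z : ℂ}
    (hz : τ (f (σ.symm (z : OnePoint ℂ))) ≠ ((0 : ℂ) : OnePoint ℂ))
    (hz' : τ (f (σ.symm (z : OnePoint ℂ))) ≠ OnePoint.infty) :
    meromorphicOrderAt (inCharts σ τ f) z = 0 := by
  have h := hf.1.2 σ hσ τ hτ z hz'
  have h0 : inCharts σ τ f z ≠ 0 := by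
    intro h0
    rw [inCharts_apply] at h0
    rw [← coe_finitePart hz', h0] at hz
    exact hz rfl
  rw [h.meromorphicOrderAt_eq, h.analyticOrderAt_eq_zero.2 h0]
  rfl

lemma IsRamifiedCover.meromorphicOrderAt_ne_top {f : S → S'} (hf : IsRamifiedCover f)
    {σ : S ≃ₜ OnePoint ℂ} {τ : S' ≃ₜ OnePoint ℂ} (hσ : σ ∈ charts S) (hτ : τ ∈ charts S') (z : ℂ) :
    meromorphicOrderAt (inCharts σ τ f) z ≠ ⊤ := by
  by_cases hz : τ (f (σ.symm (z : OnePoint ℂ))) = ((0 : ℂ) : OnePoint ℂ)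
  · rw [hf.meromorphicOrderAt_of_zero hσ hτ hz]
    exact WithTop.coe_ne_top
  by_cases hz' : τ (f (σ.symm (z : OnePoint ℂ))) = OnePoint.infty
  · rw [hf.meromorphicOrderAt_of_infty hσ hτ hz']
    exact WithTop.coe_ne_top
  · rw [hf.meromorphicOrderAt_of_ne hσ hτ hz hz']
    exact WithTop.zero_ne_top

end LocalDegree

end SphereTrees

namespace SphereTrees

open Filter Topology Bornology

/-! ### Liouville-type theorems for meromorphic functions on the sphere -/

/-- With order `0` everywhere, `H` has only removable singularities; its normal form is entire with
a limit at infinity, hence constant by Liouville. -/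
lemma eventually_eq_of_meromorphicOrderAt_eq_zero {H : ℂ → ℂ} {c : ℂ}
    (hH : ∀ z, MeromorphicAt H z) (h0 : ∀ z, meromorphicOrderAt H z = 0)
    (hc : Tendsto H (cobounded ℂ) (𝓝 c)) (z : ℂ) : ∀ᶠ w in 𝓝[≠] z, H w = c := by
  have hM : MeromorphicOn H Set.univ := fun z _ => hH z
  set E := toMeromorphicNFOn H Set.univ
  have hEH : ∀ z, E =ᶠ[𝓝[≠] z] H := fun z =>
    hM.toMeromorphicNFOn_eq_self_on_nhdsNE (Set.mem_univ z)
  have hEan : ∀ z, AnalyticAt ℂ E z := fun z => by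
    rw [← (meromorphicNFOn_toMeromorphicNFOn H Set.univ
      (Set.mem_univ z)).meromorphicOrderAt_nonneg_iff_analyticAt]
    rw [meromorphicOrderAt_congr (hEH z), h0]
  -- `E` and `H` may differ at isolated points. The bound `ε / 2` for `H` passes to `E` at such a
  -- point as a non-strict inequality, by continuity of `E`.
  have hE : Tendsto E (cobounded ℂ) (𝓝 c) := by
    rw [Metric.tendsto_nhds] at hc ⊢
    intro ε hε
    have h1 := hc (ε / 2) (half_pos hε)
    rw [Filter.Eventually, (Metric.hasBasis_cobounded_compl_closedBall (0 : ℂ)).mem_iff] at h1 ⊢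
    obtain ⟨r, hr, h1⟩ := h1
    refine ⟨r, hr, fun w hw => ?_⟩
    have hopen : (Metric.closedBall (0 : ℂ) r)ᶜ ∈ 𝓝 w :=
      Metric.isClosed_closedBall.isOpen_compl.mem_nhds hw
    have h2 : ∀ᶠ x in 𝓝[≠] w, dist (E x) c ≤ ε / 2 := by
      filter_upwards [hEH w, mem_nhdsWithin_of_mem_nhds hopen] with x hx hx'
      rw [hx]
      exact (h1 hx').le
    have h3 : Tendsto (fun x => dist (E x) c) (𝓝[≠] w) (𝓝 (dist (E w) c)) :=
      Tendsto.mono_left (Tendsto.dist (hEan w).continuousAt tendsto_const_nhds) nhdsWithin_le_nhds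
    exact (le_of_tendsto h3 h2).trans_lt (half_lt_self hε)
  have hconst : ∀ w, E w = c := fun w =>
    Differentiable.apply_eq_of_tendsto_cocompact (fun z => (hEan z).differentiableAt) w
      (by rwa [← Metric.cobounded_eq_cocompact])
  filter_upwards [hEH z] with w hw
  rw [← hw, hconst]

/-- By Liouville `H` would vanish near every point with the point removed, so its order would be `⊤`
and not `0`. -/
lemma not_tendsto_zero_of_meromorphicOrderAt_eq_zero {H : ℂ → ℂ}
    (hH : ∀ z, MeromorphicAt H z) (h0 : ∀ z, meromorphicOrderAt H z = 0) :
    ¬ Tendsto H (cobounded ℂ) (𝓝 0) := by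
  intro hc
  have h1 := meromorphicOrderAt_eq_top_iff.2
    (eventually_eq_of_meromorphicOrderAt_eq_zero hH h0 hc 0)
  rw [h0] at h1
  exact WithTop.zero_ne_top h1

lemma tendsto_zpow_neg_cobounded {N : ℤ} (hN : 0 < N) :
    Tendsto (fun w : ℂ => w ^ (-N)) (cobounded ℂ) (𝓝 0) := by
  obtain ⟨n, rfl⟩ := Int.eq_ofNat_of_zero_le hN.le
  have hn : n ≠ 0 := by
    rintro rfl
    simp at hN
  have h := (tendsto_inv₀_cobounded (α := ℂ)).pow n
  rw [zero_pow hn] at h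
  refine h.congr fun w => ?_
  simp

lemma zpow_finset_sum {w : ℂ} (hw : w ≠ 0) (F : Finset ℂ) (e : ℂ → ℤ) :
    w ^ (∑ u ∈ F, e u) = ∏ u ∈ F, w ^ e u := by
  induction F using Finset.induction_on with
  | empty => simp
  | insert a s ha ih => rw [Finset.sum_insert ha, Finset.prod_insert ha, zpow_add₀ hw, ih]

/-- A meromorphic function on `ℂ` that has a finite non-zero limit at infinity has as many zeros as
poles. -/
lemma sum_order_eq_zero {g : ℂ → ℂ} {d : ℂ → ℤ} {F : Finset ℂ} {c : ℂ}
    (hg : ∀ z, MeromorphicAt g z) (hd : ∀ z, meromorphicOrderAt g z = d z)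
    (hF : ∀ z, d z ≠ 0 → z ∈ F) (hc0 : c ≠ 0) (hc : Tendsto g (cobounded ℂ) (𝓝 c)) :
    ∑ u ∈ F, d u = 0 := by
  have hfin : d.HasFiniteSupport := F.finite_toSet.subset fun z hz => hF z hz
  -- A rational function with the same zeros and poles as `g`. It grows like `w ^ N` at infinity,
  -- with `N` the sum of the orders; if `N ≠ 0`, then `R / g` or `g / R` has order `0` everywhere
  -- and tends to `0`.
  set R : ℂ → ℂ := ∏ᶠ u, (· - u) ^ d u with hR
  have hRm : ∀ z, MeromorphicAt R z := fun z =>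
    (Function.FactorizedRational.meromorphicNFOn_univ d).meromorphicOn z (Set.mem_univ z)
  have hRo : ∀ z, meromorphicOrderAt R z = d z := fun z =>
    Function.FactorizedRational.meromorphicOrderAt_eq d hfin
  have hRw : ∀ w, R w = ∏ u ∈ F, (w - u) ^ d u := by
    intro w
    rw [hR, finprod_eq_prod_of_mulSupport_subset (s := F), Finset.prod_apply]
    · rfl
    · rw [Function.FactorizedRational.mulSupport]
      exact fun z hz => hF z hz
  set N := ∑ u ∈ F, d u with hN
  have hasym : Tendsto (fun w => R w * w ^ (-N)) (cobounded ℂ) (𝓝 1) := by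
    have h1 : Tendsto (fun w : ℂ => ∏ u ∈ F, (1 - u * w⁻¹) ^ d u) (cobounded ℂ)
        (𝓝 (∏ u ∈ F, (1 : ℂ))) := by
      refine tendsto_finsetProd _ fun u _ => ?_
      have h2 : Tendsto (fun w : ℂ => 1 - u * w⁻¹) (cobounded ℂ) (𝓝 (1 - u * 0)) :=
        tendsto_const_nhds.sub (tendsto_const_nhds.mul tendsto_inv₀_cobounded)
      rw [mul_zero, sub_zero] at h2
      simpa using h2.zpow₀ (d u) (Or.inl one_ne_zero)
    rw [Finset.prod_const_one] at h1
    refine h1.congr' ?_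
    filter_upwards [eventually_ne_cobounded (0 : ℂ)] with w hw
    have h3 : w ^ (-N) = ∏ u ∈ F, w ^ (-d u) := by
      rw [hN, ← Finset.sum_neg_distrib]
      exact zpow_finset_sum hw F fun u => -d u
    rw [hRw, h3, ← Finset.prod_mul_distrib]
    refine Finset.prod_congr rfl fun u _ => ?_
    rw [zpow_neg, ← inv_zpow, ← mul_zpow, sub_mul, mul_inv_cancel₀ hw]
  rcases lt_trichotomy N 0 with hlt | heq | hgt
  · exfalso
    refine not_tendsto_zero_of_meromorphicOrderAt_eq_zero (H := R * g⁻¹)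
      (fun z => (hRm z).mul (hg z).inv) (fun z => ?_) ?_
    · rw [meromorphicOrderAt_mul (hRm z) (hg z).inv, meromorphicOrderAt_inv, hd, hRo]
      exact_mod_cast add_neg_cancel (d z)
    · have h := (hasym.mul (tendsto_zpow_neg_cobounded (N := -N) (by omega))).mul (hc.inv₀ hc0)
      rw [mul_zero, zero_mul] at h
      refine h.congr' ?_
      filter_upwards [eventually_ne_cobounded (0 : ℂ)] with w hw
      simp only [Pi.mul_apply, Pi.inv_apply, zpow_neg, inv_inv]
      field_simp
  · exact heq
  · exfalso
    refine not_tendsto_zero_of_meromorphicOrderAt_eq_zero (H := g * R⁻¹)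
      (fun z => (hg z).mul (hRm z).inv) (fun z => ?_) ?_
    · rw [meromorphicOrderAt_mul (hg z) (hRm z).inv, meromorphicOrderAt_inv, hd, hRo]
      exact_mod_cast add_neg_cancel (d z)
    · have h := (hc.mul (hasym.inv₀ one_ne_zero)).mul (tendsto_zpow_neg_cobounded hgt)
      rw [mul_zero] at h
      refine h.congr' ?_
      filter_upwards [eventually_ne_cobounded (0 : ℂ)] with w hw
      have : w ^ (-N) ≠ 0 := zpow_ne_zero _ hw
      simp only [Pi.mul_apply, Pi.inv_apply, mul_inv]
      rw [mul_assoc, mul_assoc, inv_mul_cancel₀ this, mul_one]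

/-! ### Degree and rigidity of ramified covers between spheres -/

section Spheres

variable {S S' S'' : Type v} [TopologicalSpace S] [TopologicalSpace S'] [TopologicalSpace S'']

lemma inversion_trans_symm_inv (σ : S ≃ₜ OnePoint ℂ) {z : ℂ} (hz : z ≠ 0) :
    (σ.trans inversionHomeo).symm ((z⁻¹ : ℂ) : OnePoint ℂ) = σ.symm (z : OnePoint ℂ) := by
  rw [Homeomorph.symm_apply_eq]
  simp [inversionGL_smul_coe hz]

lemma inversion_trans_symm_zero (σ : S ≃ₜ OnePoint ℂ) :
    (σ.trans inversionHomeo).symm ((0 : ℂ) : OnePoint ℂ) = σ.symm OnePoint.infty := by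
  rw [Homeomorph.symm_apply_eq]
  simp [inversionGL_smul_infty]

variable [ProjectiveStructure S] [ProjectiveStructure S'] [ProjectiveStructure S'']

/-- `G` is `F` read in the coordinate `1 / z`, so order `0` of `G` at `0` says that `F` has neither
a zero nor a pole at infinity. -/
lemma tendsto_cobounded_of_order_eq_zero {F G : ℂ → ℂ} (hFG : ∀ z, z ≠ 0 → F z = G z⁻¹)
    (hG : MeromorphicAt G 0) (h0 : meromorphicOrderAt G 0 = 0) :
    ∃ c ≠ 0, Tendsto F (cobounded ℂ) (𝓝 c) := by
  obtain ⟨c, hc, h⟩ := tendsto_ne_zero_of_meromorphicOrderAt_eq_zero hG h0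
  refine ⟨c, hc, (h.comp tendsto_inv₀_cobounded').congr' ?_⟩
  filter_upwards [eventually_ne_cobounded (0 : ℂ)] with z hz
  exact (hFG z hz).symm

/-- The number of preimages, counted with local degrees, does not depend on the point. -/
lemma IsRamifiedCover.sum_localDegree_eq {f : S → S'} (hf : IsRamifiedCover f) {q q' : S'}
    (hq : q ≠ q') {A B : Finset S} (hA : ∀ s, s ∈ A ↔ f s = q) (hB : ∀ s, s ∈ B ↔ f s = q') :
    ∑ s ∈ A, localDegree f s = ∑ s ∈ B, localDegree f s := by
  classical
  have := infinite_of_projectiveStructure S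
  -- A point outside both fibres is put at `∞`, so that all zeros and poles lie in the finite part
  -- of the chart.
  obtain ⟨s₁, hs₁⟩ := (A ∪ B).exists_notMem
  rw [Finset.mem_union, not_or] at hs₁
  obtain ⟨σ, hσ, hσ₁⟩ := exists_chart_infty s₁
  obtain ⟨τ, hτ, hτq, hτq'⟩ := exists_chart_zero_infty hq
  have hAB : Disjoint A B := by
    rw [Finset.disjoint_left]
    intro s h1 h2
    exact hq (((hA s).1 h1).symm.trans ((hB s).1 h2))
  have hiff0 : ∀ s, τ (f s) = ((0 : ℂ) : OnePoint ℂ) ↔ s ∈ A := fun s => by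
    rw [hA, ← hτq, τ.injective.eq_iff]
  have hiff1 : ∀ s, τ (f s) = OnePoint.infty ↔ s ∈ B := fun s => by
    rw [hB, ← hτq', τ.injective.eq_iff]
  set D : S → ℤ := fun s => if s ∈ A then (localDegree f s : ℤ) else
    if s ∈ B then -(localDegree f s : ℤ) else 0 with hD
  have horder : ∀ σ' ∈ charts S, ∀ z : ℂ,
      meromorphicOrderAt (inCharts σ' τ f) z = D (σ'.symm (z : OnePoint ℂ)) := by
    intro σ' hσ' z
    by_cases h1 : σ'.symm (z : OnePoint ℂ) ∈ A
    · rw [hf.meromorphicOrderAt_of_zero hσ' hτ ((hiff0 _).2 h1)]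
      simp [hD, h1]
    by_cases h2 : σ'.symm (z : OnePoint ℂ) ∈ B
    · rw [hf.meromorphicOrderAt_of_infty hσ' hτ ((hiff1 _).2 h2)]
      simp [hD, h1, h2]
    · rw [hf.meromorphicOrderAt_of_ne hσ' hτ (fun h => h1 ((hiff0 _).1 h))
        (fun h => h2 ((hiff1 _).1 h))]
      simp [hD, h1, h2]
  obtain ⟨c, hc, hlim⟩ := tendsto_cobounded_of_order_eq_zero
    (F := inCharts σ τ f) (G := inCharts (σ.trans inversionHomeo) τ f)
    (fun z hz => by rw [inCharts_apply, inCharts_apply, inversion_trans_symm_inv σ hz])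
    (hf.meromorphicAt (charts_trans_inversion hσ) hτ 0) (by
      rw [horder _ (charts_trans_inversion hσ), inversion_trans_symm_zero, ← hσ₁,
        σ.symm_apply_apply]
      simp [hD, hs₁.1, hs₁.2])
  have hne : ∀ s ∈ A ∪ B, σ s ≠ OnePoint.infty := by
    intro s hs h
    rw [← hσ₁, σ.injective.eq_iff] at h
    subst h
    exact (Finset.mem_union.1 hs).elim hs₁.1 hs₁.2
  have hsum := sum_order_eq_zero (g := inCharts σ τ f)
    (d := fun z => D (σ.symm (z : OnePoint ℂ)))
    (F := (A ∪ B).image fun s => finitePart (σ s)) (fun z => hf.meromorphicAt hσ hτ z)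
    (horder σ hσ) (fun z hz => by
      rw [Finset.mem_image]
      refine ⟨σ.symm (z : OnePoint ℂ), ?_, by simp⟩
      by_contra hcon
      rw [Finset.mem_union, not_or] at hcon
      simp [hD, hcon.1, hcon.2] at hz) hc hlim
  rw [Finset.sum_image] at hsum
  · have h2 : ∑ s ∈ A ∪ B, D s = 0 := by
      rw [← hsum]
      refine Finset.sum_congr rfl fun s hs => ?_
      rw [coe_finitePart (hne s hs), σ.symm_apply_apply]
    rw [Finset.sum_union hAB] at h2
    have hA' : ∑ s ∈ A, D s = ∑ s ∈ A, (localDegree f s : ℤ) :=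
      Finset.sum_congr rfl fun s hs => by simp [hD, hs]
    have hB' : ∑ s ∈ B, D s = -∑ s ∈ B, (localDegree f s : ℤ) := by
      rw [← Finset.sum_neg_distrib]
      exact Finset.sum_congr rfl fun s hs => by simp [hD, hs, Finset.disjoint_right.1 hAB hs]
    rw [hA', hB'] at h2
    have h3 : ∑ s ∈ A, (localDegree f s : ℤ) = ∑ s ∈ B, (localDegree f s : ℤ) := by linarith
    exact_mod_cast h3
  · intro s hs t ht hst
    apply σ.injective
    rw [← coe_finitePart (hne s hs), ← coe_finitePart (hne t ht)]
    exact congrArg _ hst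

/-- A ramified cover is determined by its fibres, with multiplicities, over two points, and by its
value at one more point. -/
lemma IsRamifiedCover.eq_of_fibres {f₁ : S → S'} {f₂ : S → S''} (h₁ : IsRamifiedCover f₁)
    (h₂ : IsRamifiedCover f₂) {τ₁ : S' ≃ₜ OnePoint ℂ} {τ₂ : S'' ≃ₜ OnePoint ℂ}
    (hτ₁ : τ₁ ∈ charts S') (hτ₂ : τ₂ ∈ charts S'')
    (hzero : ∀ s, τ₁ (f₁ s) = ((0 : ℂ) : OnePoint ℂ) ↔ τ₂ (f₂ s) = ((0 : ℂ) : OnePoint ℂ))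
    (hinfty : ∀ s, τ₁ (f₁ s) = OnePoint.infty ↔ τ₂ (f₂ s) = OnePoint.infty)
    (hzero_deg : ∀ s, τ₁ (f₁ s) = ((0 : ℂ) : OnePoint ℂ) → localDegree f₁ s = localDegree f₂ s)
    (hinfty_deg : ∀ s, τ₁ (f₁ s) = OnePoint.infty → localDegree f₁ s = localDegree f₂ s)
    {s₀ : S} (hs₁ : τ₁ (f₁ s₀) = ((1 : ℂ) : OnePoint ℂ))
    (hs₂ : τ₂ (f₂ s₀) = ((1 : ℂ) : OnePoint ℂ)) (s : S) : τ₁ (f₁ s) = τ₂ (f₂ s) := by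
  have horder : ∀ σ ∈ charts S, ∀ z : ℂ, meromorphicOrderAt (inCharts σ τ₁ f₁) z =
      meromorphicOrderAt (inCharts σ τ₂ f₂) z := by
    intro σ hσ z
    by_cases ha : τ₁ (f₁ (σ.symm (z : OnePoint ℂ))) = ((0 : ℂ) : OnePoint ℂ)
    · rw [h₁.meromorphicOrderAt_of_zero hσ hτ₁ ha,
        h₂.meromorphicOrderAt_of_zero hσ hτ₂ ((hzero _).1 ha), hzero_deg _ ha]
    by_cases hb : τ₁ (f₁ (σ.symm (z : OnePoint ℂ))) = OnePoint.infty
    · rw [h₁.meromorphicOrderAt_of_infty hσ hτ₁ hb,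
        h₂.meromorphicOrderAt_of_infty hσ hτ₂ ((hinfty _).1 hb), hinfty_deg _ hb]
    · rw [h₁.meromorphicOrderAt_of_ne hσ hτ₁ ha hb,
        h₂.meromorphicOrderAt_of_ne hσ hτ₂ (fun h => ha ((hzero _).2 h))
          (fun h => hb ((hinfty _).2 h))]
  have hmer : ∀ σ ∈ charts S, ∀ z : ℂ,
      MeromorphicAt (inCharts σ τ₁ f₁ * (inCharts σ τ₂ f₂)⁻¹) z := fun σ hσ z =>
    (h₁.meromorphicAt hσ hτ₁ z).mul (h₂.meromorphicAt hσ hτ₂ z).inv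
  have hord0 : ∀ σ ∈ charts S, ∀ z : ℂ,
      meromorphicOrderAt (inCharts σ τ₁ f₁ * (inCharts σ τ₂ f₂)⁻¹) z = 0 := by
    intro σ hσ z
    rw [meromorphicOrderAt_mul (h₁.meromorphicAt hσ hτ₁ z) (h₂.meromorphicAt hσ hτ₂ z).inv,
      meromorphicOrderAt_inv, horder σ hσ]
    -- Equal orders cancel because they are finite, neither map being constant.
    exact LinearOrderedAddCommGroupWithTop.add_neg_cancel_of_ne_top
      (h₂.meromorphicOrderAt_ne_top hσ hτ₂ z)
  obtain ⟨σ, hσ, hσ₀⟩ := exists_chart_zero s₀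
  have hs₀ : σ.symm ((0 : ℂ) : OnePoint ℂ) = s₀ := by rw [← hσ₀, σ.symm_apply_apply]
  obtain ⟨c, hc, hlim⟩ := tendsto_cobounded_of_order_eq_zero
    (F := inCharts σ τ₁ f₁ * (inCharts σ τ₂ f₂)⁻¹)
    (G := inCharts (σ.trans inversionHomeo) τ₁ f₁ * (inCharts (σ.trans inversionHomeo) τ₂ f₂)⁻¹)
    (fun z hz => by
      simp only [Pi.mul_apply, Pi.inv_apply]
      rw [inCharts_apply, inCharts_apply, inCharts_apply, inCharts_apply,
        inversion_trans_symm_inv σ hz])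
    (hmer _ (charts_trans_inversion hσ) 0) (hord0 _ (charts_trans_inversion hσ) 0)
  have hconst := eventually_eq_of_meromorphicOrderAt_eq_zero (hmer σ hσ) (hord0 σ hσ) hlim
  -- The quotient is known to be `c` only off the centre of the chart; continuity at `s₀`, where
  -- both expressions are `1`, identifies `c`.
  have hc1 : c = 1 := by
    have e1 : AnalyticAt ℂ (inCharts σ τ₁ f₁) 0 := h₁.1.2 σ hσ τ₁ hτ₁ 0
      (by rw [hs₀, hs₁]; exact OnePoint.coe_ne_infty _)
    have e2 : AnalyticAt ℂ (inCharts σ τ₂ f₂) 0 := h₂.1.2 σ hσ τ₂ hτ₂ 0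
      (by rw [hs₀, hs₂]; exact OnePoint.coe_ne_infty _)
    have v1 : inCharts σ τ₁ f₁ 0 = 1 := by rw [inCharts_apply, hs₀, hs₁, finitePart_coe]
    have v2 : inCharts σ τ₂ f₂ 0 = 1 := by rw [inCharts_apply, hs₀, hs₂, finitePart_coe]
    have h3 : Tendsto (inCharts σ τ₁ f₁ * (inCharts σ τ₂ f₂)⁻¹) (𝓝[≠] 0) (𝓝 (1 * 1⁻¹)) := by
      have := (e1.continuousAt.mul (e2.continuousAt.inv₀ (by rw [v2]; exact one_ne_zero))).tendsto
      simp only [Pi.mul_apply, Pi.inv_apply, v1, v2] at this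
      exact this.mono_left nhdsWithin_le_nhds
    rw [inv_one, mul_one] at h3
    exact tendsto_nhds_unique (tendsto_const_nhds.congr' ((hconst 0).mono fun w hw => hw.symm)) h3
  subst hc1
  have := t2Space_of_projectiveStructure S'
  have hclosed : IsClosed {s | τ₁ (f₁ s) = τ₂ (f₂ s)} :=
    isClosed_eq (τ₁.continuous.comp h₁.1.1) (τ₂.continuous.comp h₂.1.1)
  have hfinite : ∀ z : ℂ, τ₁ (f₁ (σ.symm (z : OnePoint ℂ))) =
      τ₂ (f₂ (σ.symm (z : OnePoint ℂ))) := by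
    intro z
    have hcl : IsClosed {z : ℂ | τ₁ (f₁ (σ.symm (z : OnePoint ℂ))) =
        τ₂ (f₂ (σ.symm (z : OnePoint ℂ)))} := hclosed.preimage (continuous_symm_coe σ)
    have hev : ∀ᶠ w : ℂ in 𝓝[≠] z, τ₁ (f₁ (σ.symm (w : OnePoint ℂ))) =
        τ₂ (f₂ (σ.symm (w : OnePoint ℂ))) := by
      filter_upwards [hconst z] with w hw
      -- A quotient equal to `1` excludes the value `0`, and with it the dummy value at `∞`, so
      -- equal finite parts give equal points.
      have hfin : ∀ p : OnePoint ℂ, finitePart p ≠ 0 → (finitePart p : OnePoint ℂ) = p := by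
        intro p hp
        refine coe_finitePart ?_
        rintro rfl
        exact hp rfl
      simp only [Pi.mul_apply, Pi.inv_apply] at hw
      have hb : inCharts σ τ₂ f₂ w ≠ 0 := by
        intro h
        rw [h] at hw
        simp at hw
      have hab : inCharts σ τ₁ f₁ w = inCharts σ τ₂ f₂ w := by
        field_simp at hw
        exact hw
      rw [inCharts_apply] at hb
      rw [inCharts_apply, inCharts_apply] at hab
      rw [← hfin _ hb, ← hab, hfin]
      rwa [hab]
    exact hcl.closure_subset (mem_closure_iff_frequently.2
      (hev.frequently.filter_mono nhdsWithin_le_nhds))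
  have hdense : DenseRange fun z : ℂ => σ.symm (z : OnePoint ℂ) :=
    σ.symm.surjective.denseRange.comp OnePoint.denseRange_coe σ.symm.continuous
  have := hclosed.closure_subset_iff.2 (Set.range_subset_iff.2 hfinite)
  rw [hdense.closure_eq] at this
  exact this (Set.mem_univ s)

end Spheres

end SphereTrees

namespace SphereTrees

/-! ### Branches of trees -/

section Branches

variable {V : Type*} {G : SimpleGraph V}

/-- The branch at `v` in the direction of the neighbour `a`: the vertices that can be reached from
`a` without crossing the edge between `v` and `a`. -/
def branch (G : SimpleGraph V) (v a : V) : Set V :=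
  {x | (G.deleteEdges {s(v, a)}).Reachable a x}

lemma self_mem_branch (v a : V) : a ∈ branch G v a := SimpleGraph.Reachable.refl a

lemma eq_of_mem_of_adj_of_notMem_branch {v a x y : V} (h : G.Adj x y) (hx : x ∈ branch G v a)
    (hy : y ∉ branch G v a) (hv : v ∉ branch G v a) : x = a ∧ y = v := by
  by_cases he : s(x, y) = s(v, a)
  · rcases Sym2.eq_iff.1 he with ⟨rfl, rfl⟩ | ⟨rfl, rfl⟩
    · exact absurd hx hv
    · exact ⟨rfl, rfl⟩
  · exact absurd (SimpleGraph.Reachable.trans hx (SimpleGraph.Adj.reachable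
      (SimpleGraph.deleteEdges_adj.2 ⟨h, by simpa using he⟩))) hy

/-- A path from `a` that avoids the edge `va` stays in the branch, so a property only has to
propagate along edges inside it. -/
lemma branch_induction {v a : V} {p : V → Prop} (base : p a)
    (step : ∀ x y, x ∈ branch G v a → y ∈ branch G v a → G.Adj x y → p x → p y) {x : V}
    (hx : x ∈ branch G v a) : p x := by
  change (G.deleteEdges {s(v, a)}).Reachable a x at hx
  rw [SimpleGraph.reachable_iff_reflTransGen] at hx
  induction hx with
  | refl => exact base
  | tail hb hbc ih =>
    rw [← SimpleGraph.reachable_iff_reflTransGen] at hb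
    exact step _ _ hb (hb.trans hbc.reachable) (SimpleGraph.deleteEdges_adj.1 hbc).1 ih

lemma connected_induction (hG : G.Connected) {p : V → Prop} {a : V} (base : p a)
    (step : ∀ x y, G.Adj x y → p x → p y) (x : V) : p x := by
  have hx := hG.preconnected a x
  rw [SimpleGraph.reachable_iff_reflTransGen] at hx
  induction hx with
  | refl => exact base
  | tail hb hbc ih => exact step _ _ hbc ih

variable (hG : G.IsTree)
include hG

lemma notMem_branch {v a : V} (h : G.Adj v a) : v ∉ branch G v a := fun hv =>
  (SimpleGraph.isAcyclic_iff_forall_adj_isBridge.1 hG.isAcyclic h) (SimpleGraph.Reachable.symm hv)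

lemma branch_boundary {v a x y : V} (hva : G.Adj v a) (h : G.Adj x y) (hx : x ∈ branch G v a)
    (hy : y ∉ branch G v a) : x = a ∧ y = v :=
  eq_of_mem_of_adj_of_notMem_branch h hx hy (notMem_branch hG hva)

lemma eq_of_adj_of_mem_branch {v a b : V} (ha : G.Adj v a) (hb : G.Adj v b)
    (h : b ∈ branch G v a) : b = a :=
  (branch_boundary hG ha hb.symm h (notMem_branch hG ha)).1

/-- Moving inside one branch, another branch at `v` can be entered only through `v`, which lies in
neither. -/
lemma branch_disjoint {v a b x : V} (ha : G.Adj v a) (hb : G.Adj v b) (hxa : x ∈ branch G v a)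
    (hxb : x ∈ branch G v b) : a = b := by
  by_contra hab
  refine branch_induction (p := fun x => x ∉ branch G v b)
    (fun h => hab (eq_of_adj_of_mem_branch hG hb ha h)) ?_ hxa hxb
  intro x y hx _ hxy hxb hyb
  obtain ⟨-, rfl⟩ := branch_boundary hG hb hxy.symm hyb hxb
  exact notMem_branch hG ha hx

/-- The only exit from the larger branch leads to `w'`, and the smaller branch does not contain
`w'`. -/
lemma branch_subset {w p w' u' : V} (hp : G.Adj w p) (hu : G.Adj w' u')
    (hw : w ∈ branch G w' u') (hw' : w' ∉ branch G w p) : branch G w p ⊆ branch G w' u' := by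
  intro x hx
  refine branch_induction (p := fun x => x ∈ branch G w' u') ?_ ?_ hx
  · by_contra hcon
    obtain ⟨-, rfl⟩ := branch_boundary hG hu hp hw hcon
    exact hw' (self_mem_branch _ _)
  · intro x y _ hy hxy hx
    by_contra hcon
    obtain ⟨-, rfl⟩ := branch_boundary hG hu hxy hx hcon
    exact hw' hy

lemma exists_mem_branch {w x : V} (h : w ≠ x) : ∃ u, G.Adj w u ∧ x ∈ branch G w u := by
  refine (connected_induction hG.connected (p := fun x => w = x ∨ ∃ u, G.Adj w u ∧ x ∈ branch G w u)
    (Or.inl rfl) ?_ x).resolve_left h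
  rintro x y hxy (rfl | ⟨u, hu, hx⟩)
  · exact Or.inr ⟨y, hxy, self_mem_branch _ _⟩
  · by_cases hy : y ∈ branch G w u
    · exact Or.inr ⟨u, hu, hy⟩
    · exact Or.inl (branch_boundary hG hu hxy hx hy).2.symm

/-- Two distinct vertices, one of which has valence at least `3`, are told apart by the branches at
them. -/
lemma exists_two_branches_subset {w w' : V} (hne : w ≠ w') (h3 : 3 ≤ (G.neighborSet w).ncard) :
    ∃ p q u', p ≠ q ∧ G.Adj w p ∧ G.Adj w q ∧ G.Adj w' u' ∧
      branch G w p ⊆ branch G w' u' ∧ branch G w q ⊆ branch G w' u' := by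
  obtain ⟨u, hu, hw'⟩ := exists_mem_branch hG hne
  obtain ⟨u', hu', hw⟩ := exists_mem_branch hG hne.symm
  have hfin : (G.neighborSet w).Finite := Set.finite_of_ncard_pos (by omega)
  -- Only the branch towards `u` contains `w'`. At least two other neighbours of `w` remain, and
  -- their branches all lie on the side of `w` as seen from `w'`.
  have h2 : 1 < (G.neighborSet w \ {u}).ncard := by
    have := Set.ncard_sdiff_singleton_add_one (s := G.neighborSet w) hu hfin
    omega
  obtain ⟨p, q, hp, hq, hpq⟩ := (Set.one_lt_ncard_iff (hfin.subset Set.sdiff_subset)).1 h2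
  refine ⟨p, q, u', hpq, hp.1, hq.1, hu', ?_, ?_⟩
  · exact branch_subset hG hp.1 hu' hw fun h => hp.2 (branch_disjoint hG hp.1 hu h hw')
  · exact branch_subset hG hq.1 hu' hw fun h => hq.2 (branch_disjoint hG hq.1 hu h hw')

/-- In a finite tree in which all vertices outside `L` have valence at least `3`, every branch
meets `L`. -/
lemma exists_mem_branch_of_valence [Finite V] {L : Set V}
    (hL : ∀ x ∉ L, 3 ≤ (G.neighborSet x).ncard) {v a : V} (h : G.Adj v a) :
    ∃ z ∈ L, z ∈ branch G v a := by
  induction hn : (branch G v a).ncard using Nat.strong_induction_on generalizing v a with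
  | _ n ih =>
    subst hn
    by_cases ha : a ∈ L
    · exact ⟨a, ha, self_mem_branch _ _⟩
    · have hfin : (G.neighborSet a).Finite := Set.toFinite _
      have h2 : 0 < (G.neighborSet a \ {v}).ncard := by
        have := Set.ncard_sdiff_singleton_add_one (s := G.neighborSet a) h.symm hfin
        have := hL a ha
        omega
      obtain ⟨b, hb, hbv⟩ := (Set.ncard_pos (Set.toFinite _)).1 h2
      have hsub : branch G a b ⊆ branch G v a :=
        branch_subset hG hb h (self_mem_branch _ _) fun hv =>
          hbv (eq_of_adj_of_mem_branch hG hb h.symm hv).symm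
      -- Strict descent: the smaller branch misses `a`.
      have hlt : (branch G a b).ncard < (branch G v a).ncard :=
        Set.ncard_lt_ncard ⟨hsub, fun hsup => notMem_branch hG hb (hsup (self_mem_branch _ _))⟩
          (Set.toFinite _)
      obtain ⟨z, hz, hzb⟩ := ih _ hlt hb rfl
      exact ⟨z, hz, hsub hzb⟩

/-- The complement of a branch contains a branch. -/
lemma exists_notMem_branch_of_valence [Finite V] {L : Set V}
    (hL : ∀ x ∉ L, 3 ≤ (G.neighborSet x).ncard) {v a : V} (h : G.Adj v a) :
    ∃ z ∈ L, z ∉ branch G v a := by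
  obtain ⟨z, hz, hzb⟩ := exists_mem_branch_of_valence hG hL h.symm
  refine ⟨z, hz, ?_⟩
  refine branch_induction (p := fun z => z ∉ branch G v a) (notMem_branch hG h) ?_ hzb
  intro x y hx hy hxy hxa hya
  obtain ⟨rfl, rfl⟩ := branch_boundary hG h hxy.symm hya hxa
  exact notMem_branch hG h.symm hy

end Branches

/-! ### Harmonic maps of trees -/

/-- A graph homomorphism with weights on the edges such that the weights of the edges at a vertex
that lie over an edge of the target add up to a degree of the vertex. -/
structure HarmonicMap {V V' : Type*} [Fintype V] (G : SimpleGraph V) (G' : SimpleGraph V') where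
  toFun : V → V'
  weight : V → V → ℤ
  degree : V → ℤ
  map_adj : ∀ {x y}, G.Adj x y → G'.Adj (toFun x) (toFun y)
  weight_symm : ∀ {x y}, G.Adj x y → weight x y = weight y x
  weight_pos : ∀ {x y}, G.Adj x y → 0 < weight x y
  degree_pos : ∀ x, 0 < degree x
  sum_weight : ∀ x u', G'.Adj (toFun x) u' →
    (open scoped Classical in ∑ a with G.Adj x a ∧ toFun a = u', weight x a) = degree x

namespace HarmonicMap

open scoped Classical in
section

variable {V V' : Type*} [Fintype V] {G : SimpleGraph V} {G' : SimpleGraph V'}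

/-- Edges lift: an empty sum of weights would make the degree `0`. -/
lemma exists_adj (Φ : HarmonicMap G G') {x : V} {u' : V'} (h : G'.Adj (Φ.toFun x) u') :
    ∃ a, G.Adj x a ∧ Φ.toFun a = u' := by
  by_contra! hcon
  have h1 := Φ.sum_weight x u' h
  rw [Finset.filter_false_of_mem (fun a _ hx => hcon a hx.1 hx.2), Finset.sum_empty] at h1
  exact (Φ.degree_pos x).ne h1

lemma surjective (Φ : HarmonicMap G G') [Nonempty V] (hG' : G'.Connected) :
    Function.Surjective Φ.toFun := by
  intro w
  refine connected_induction hG' (p := fun w => ∃ x, Φ.toFun x = w)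
    ⟨Classical.arbitrary V, rfl⟩ ?_ w
  rintro _ y hxy ⟨x, rfl⟩
  obtain ⟨a, -, ha⟩ := Φ.exists_adj hxy
  exact ⟨a, ha⟩

/-- A branch of the source covers the vertices of the corresponding branch of the target more often
than the other vertices, the excess being the weight of the edge. -/
lemma exists_sum_degree_branch (Φ : HarmonicMap G G') (hG : G.IsTree) (hG' : G'.IsTree) {v a : V}
    (h : G.Adj v a) : ∃ k : ℤ, ∀ w', ∑ x with x ∈ branch G v a ∧ Φ.toFun x = w', Φ.degree x =
      k + if w' ∈ branch G' (Φ.toFun v) (Φ.toFun a) then Φ.weight v a else 0 := by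
  set B := branch G v a with hB
  set B' := branch G' (Φ.toFun v) (Φ.toFun a) with hB'
  set D : V' → ℤ := fun w' => ∑ x with x ∈ B ∧ Φ.toFun x = w', Φ.degree x with hD
  -- The weights of the edges over `w'w''` that start in the branch are split into `I`, for edges
  -- staying inside, and `J`, for the only edge leaving, from `a` to `v`. Reversing edges shows that
  -- `I` is symmetric, so it cancels in `D w' - D w''`.
  set I : V' → V' → ℤ := fun w' w'' => ∑ x, ∑ y,
    if (x ∈ B ∧ y ∈ B) ∧ G.Adj x y ∧ Φ.toFun x = w' ∧ Φ.toFun y = w'' then Φ.weight x y else 0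
    with hI
  set J : V' → V' → ℤ := fun w' w'' =>
    if Φ.toFun a = w' ∧ Φ.toFun v = w'' then Φ.weight v a else 0 with hJ
  have hIsymm : ∀ w' w'', I w' w'' = I w'' w' := by
    intro w' w''
    simp only [hI]
    rw [Finset.sum_comm]
    refine Finset.sum_congr rfl fun x _ => Finset.sum_congr rfl fun y _ => ?_
    by_cases hxy : G.Adj x y
    · rw [Φ.weight_symm hxy]
      refine if_congr ?_ rfl rfl
      have := hxy.symm
      tauto
    · rw [if_neg (fun hc => hxy hc.2.1.symm), if_neg (fun hc => hxy hc.2.1)]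
  have hDIJ : ∀ w' w'', G'.Adj w' w'' → D w' = I w' w'' + J w' w'' := by
    intro w' w'' hw
    have h1 : D w' = ∑ x, ∑ y, if x ∈ B ∧ G.Adj x y ∧ Φ.toFun x = w' ∧ Φ.toFun y = w'' then
        Φ.weight x y else 0 := by
      simp only [hD]
      rw [Finset.sum_filter]
      refine Finset.sum_congr rfl fun x _ => ?_
      by_cases hx : x ∈ B ∧ Φ.toFun x = w'
      · rw [if_pos hx, ← Φ.sum_weight x w'' (by rw [hx.2]; exact hw), Finset.sum_filter]
        refine Finset.sum_congr rfl fun y _ => if_congr ?_ rfl rfl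
        tauto
      · rw [if_neg hx]
        refine (Finset.sum_eq_zero fun y _ => if_neg ?_).symm
        tauto
    have h2 : J w' w'' = ∑ x, ∑ y, if (x ∈ B ∧ y ∉ B) ∧ G.Adj x y ∧ Φ.toFun x = w' ∧
        Φ.toFun y = w'' then Φ.weight x y else 0 := by
      have hbd : ∀ x y, ((x ∈ B ∧ y ∉ B) ∧ G.Adj x y ∧ Φ.toFun x = w' ∧ Φ.toFun y = w'') ↔
          (x = a ∧ y = v) ∧ Φ.toFun a = w' ∧ Φ.toFun v = w'' := by
        intro x y
        constructor
        · rintro ⟨⟨hx, hy⟩, hxy, e1, e2⟩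
          obtain ⟨rfl, rfl⟩ := branch_boundary hG h hxy hx hy
          exact ⟨⟨rfl, rfl⟩, e1, e2⟩
        · rintro ⟨⟨rfl, rfl⟩, e1, e2⟩
          exact ⟨⟨self_mem_branch _ _, notMem_branch hG h⟩, h.symm, e1, e2⟩
      rw [Finset.sum_eq_single a, Finset.sum_eq_single v]
      · rw [hJ]
        simp only
        rw [Φ.weight_symm h]
        refine if_congr ?_ rfl rfl
        rw [hbd]
        tauto
      · intro y _ hy
        rw [if_neg]
        rw [hbd]
        tauto
      · simp
      · intro x _ hx
        refine Finset.sum_eq_zero fun y _ => ?_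
        rw [if_neg]
        rw [hbd]
        tauto
      · simp
    rw [h1, h2, hI]
    simp only
    rw [← Finset.sum_add_distrib]
    refine Finset.sum_congr rfl fun x _ => ?_
    rw [← Finset.sum_add_distrib]
    refine Finset.sum_congr rfl fun y _ => ?_
    by_cases hx : x ∈ B <;> by_cases hy : y ∈ B <;> simp [hx, hy]
  have hva := Φ.map_adj h
  have hstep : ∀ x y, G'.Adj x y → D x - (if x ∈ B' then Φ.weight v a else 0) =
      D y - if y ∈ B' then Φ.weight v a else 0 := by
    intro x y hxy
    rw [hDIJ x y hxy, hDIJ y x hxy.symm, hIsymm x y]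
    simp only [hJ]
    -- The image of the cut edge is the only edge on the boundary of `B'`, so the jump of `D` is
    -- that of the weighted indicator of `B'`.
    have hfwd : ∀ {x y}, G'.Adj x y → ((Φ.toFun a = x ∧ Φ.toFun v = y) ↔ (x ∈ B' ∧ y ∉ B')) := by
      intro x y hxy
      constructor
      · rintro ⟨rfl, rfl⟩
        exact ⟨self_mem_branch _ _, notMem_branch hG' hva⟩
      · rintro ⟨hx, hy⟩
        obtain ⟨rfl, rfl⟩ := branch_boundary hG' hva hxy hx hy
        exact ⟨rfl, rfl⟩
    rw [if_congr (hfwd hxy) rfl rfl, if_congr (hfwd hxy.symm) rfl rfl]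
    by_cases hx : x ∈ B' <;> by_cases hy : y ∈ B' <;> simp [hx, hy]
  refine ⟨D (Φ.toFun v) - if Φ.toFun v ∈ B' then Φ.weight v a else 0, fun w' => ?_⟩
  have := connected_induction hG'.connected
    (p := fun w => D w - (if w ∈ B' then Φ.weight v a else 0) =
      D (Φ.toFun v) - if Φ.toFun v ∈ B' then Φ.weight v a else 0) rfl
    (fun x y hxy hx => (hstep x y hxy).symm.trans hx) w'
  change D w' = _
  rw [← this]
  ring

end

/-! ### Harmonic maps between trees with marked leaves -/

variable {Y : Type*} {Z : Type*} {I I₁ I₂ : Type*} [Fintype (Y ⊕ I)]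
  {G : SimpleGraph (Y ⊕ I)} {G₁ : SimpleGraph (Z ⊕ I₁)} {G₂ : SimpleGraph (Z ⊕ I₂)}

/-- A harmonic map that is given by `f` and `e` on the leaves and maps internal vertices to internal
vertices. -/
structure OnLeaves (Φ : HarmonicMap G G₁) (f : Y → Z) (e : Y → ℤ) (m : I → I₁) : Prop where
  map_eq : Φ.toFun = Sum.map f m
  degree_inl : ∀ y, Φ.degree (Sum.inl y) = e y

/-- Only leaves lie over a leaf, and there both maps and degrees are prescribed. This lets the
counts of two harmonic maps be compared even when their targets differ. -/
lemma OnLeaves.sum_degree_eq {Φ₁ : HarmonicMap G G₁} {Φ₂ : HarmonicMap G G₂} {f : Y → Z}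
    {e : Y → ℤ} {m₁ : I → I₁} {m₂ : I → I₂} (h₁ : Φ₁.OnLeaves f e m₁) (h₂ : Φ₂.OnLeaves f e m₂)
    (B : Set (Y ⊕ I)) (z : Z) :
    (open scoped Classical in
      ∑ x with x ∈ B ∧ Φ₁.toFun x = Sum.inl z, Φ₁.degree x) =
    (open scoped Classical in
      ∑ x with x ∈ B ∧ Φ₂.toFun x = Sum.inl z, Φ₂.degree x) := by
  classical
  rw [h₁.map_eq, h₂.map_eq]
  refine Finset.sum_congr ?_ ?_
  · ext x
    cases x <;> simp
  · intro x hx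
    cases x with
    | inl y => rw [h₁.degree_inl, h₂.degree_inl]
    | inr i => simp at hx

/-- The weight of an edge, and the set of leaves that lie beyond its image, are determined by the
map on the leaves. -/
lemma OnLeaves.branch_iff {Φ₁ : HarmonicMap G G₁} {Φ₂ : HarmonicMap G G₂} {f : Y → Z}
    {e : Y → ℤ} {m₁ : I → I₁} {m₂ : I → I₂} (h₁ : Φ₁.OnLeaves f e m₁) (h₂ : Φ₂.OnLeaves f e m₂)
    [Finite (Z ⊕ I₁)] (hG : G.IsTree) (hG₁ : G₁.IsTree) (hG₂ : G₂.IsTree)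
    (hst : ∀ w : I₁, 3 ≤ (G₁.neighborSet (Sum.inr w)).ncard) {v a : Y ⊕ I} (h : G.Adj v a) :
    Φ₁.weight v a = Φ₂.weight v a ∧
      ∀ z : Z, Sum.inl z ∈ branch G₁ (Φ₁.toFun v) (Φ₁.toFun a) ↔
        Sum.inl z ∈ branch G₂ (Φ₂.toFun v) (Φ₂.toFun a) := by
  classical
  obtain ⟨k₁, hk₁⟩ := Φ₁.exists_sum_degree_branch hG hG₁ h
  obtain ⟨k₂, hk₂⟩ := Φ₂.exists_sum_degree_branch hG hG₂ h
  have key : ∀ z : Z,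
      (k₁ + if Sum.inl z ∈ branch G₁ (Φ₁.toFun v) (Φ₁.toFun a) then Φ₁.weight v a else 0) =
      k₂ + if Sum.inl z ∈ branch G₂ (Φ₂.toFun v) (Φ₂.toFun a) then Φ₂.weight v a else 0 := by
    intro z
    rw [← hk₁, ← hk₂]
    convert h₁.sum_degree_eq h₂ (branch G v a) z
  have hL : ∀ x ∉ Set.range (Sum.inl : Z → Z ⊕ I₁), 3 ≤ (G₁.neighborSet x).ncard := by
    rintro (z | w) hx
    · exact absurd ⟨z, rfl⟩ hx
    · exact hst w
  obtain ⟨_, ⟨z, rfl⟩, hz⟩ := exists_mem_branch_of_valence hG₁ hL (Φ₁.map_adj h)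
  obtain ⟨_, ⟨z', rfl⟩, hz'⟩ := exists_notMem_branch_of_valence hG₁ hL (Φ₁.map_adj h)
  have p₁ := Φ₁.weight_pos h
  have p₂ := Φ₂.weight_pos h
  have e₁ := key z
  have e₂ := key z'
  rw [if_pos hz] at e₁
  rw [if_neg hz'] at e₂
  -- Both sides of `key` are the same function of the leaf. It takes two values, and since weights
  -- are positive the larger one marks the leaves of the image branch; the other sign patterns are
  -- contradictory.
  have hw : Φ₁.weight v a = Φ₂.weight v a ∧ k₁ = k₂ := by
    split_ifs at e₁ e₂ <;> constructor <;> linarith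
  refine ⟨hw.1, fun z => ?_⟩
  have e₃ := key z
  rw [hw.1, hw.2] at e₃
  split_ifs at e₃ with c₁ c₂ c₂
  · exact iff_of_true c₁ c₂
  · linarith
  · linarith
  · exact iff_of_false c₁ c₂

/-- If `m₂` separated `i` and `j`, two branches at `m₂ i` would lie in one branch at `m₂ j`. After
lifting these edges to the source, the corresponding branches at the common vertex `m₁ i = m₁ j`
share leaves and so coincide, which forces the two branches at `m₂ i` to coincide too. -/
lemma OnLeaves.inr_eq_of_inr_eq {Φ₁ : HarmonicMap G G₁} {Φ₂ : HarmonicMap G G₂} {f : Y → Z}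
    {e : Y → ℤ} {m₁ : I → I₁} {m₂ : I → I₂} (h₁ : Φ₁.OnLeaves f e m₁) (h₂ : Φ₂.OnLeaves f e m₂)
    [Finite (Z ⊕ I₁)] [Finite (Z ⊕ I₂)] (hG : G.IsTree) (hG₁ : G₁.IsTree) (hG₂ : G₂.IsTree)
    (hst₁ : ∀ w : I₁, 3 ≤ (G₁.neighborSet (Sum.inr w)).ncard)
    (hst₂ : ∀ w : I₂, 3 ≤ (G₂.neighborSet (Sum.inr w)).ncard) {i j : I} (hij : m₁ i = m₁ j) :
    m₂ i = m₂ j := by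
  by_contra hne
  have hL : ∀ x ∉ Set.range (Sum.inl : Z → Z ⊕ I₂), 3 ≤ (G₂.neighborSet x).ncard := by
    rintro (z | w) hx
    · exact absurd ⟨z, rfl⟩ hx
    · exact hst₂ w
  have ei : ∀ i, Φ₁.toFun (Sum.inr i) = Sum.inr (m₁ i) := fun i => by rw [h₁.map_eq]; rfl
  have ei' : ∀ i, Φ₂.toFun (Sum.inr i) = Sum.inr (m₂ i) := fun i => by rw [h₂.map_eq]; rfl
  obtain ⟨p, q, u', hpq, hp, hq, hu, hsp, hsq⟩ := exists_two_branches_subset hG₂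
    (w := Φ₂.toFun (Sum.inr i)) (w' := Φ₂.toFun (Sum.inr j))
    (by rw [ei', ei']; exact fun h => hne (Sum.inr.inj h)) (by rw [ei']; exact hst₂ _)
  obtain ⟨a, ha, rfl⟩ := Φ₂.exists_adj hp
  obtain ⟨b, hb, rfl⟩ := Φ₂.exists_adj hq
  obtain ⟨c, hc, rfl⟩ := Φ₂.exists_adj hu
  have hvert : Φ₁.toFun (Sum.inr i) = Φ₁.toFun (Sum.inr j) := by rw [ei, ei, hij]
  have key : ∀ a, G.Adj (Sum.inr i) a →
      branch G₂ (Φ₂.toFun (Sum.inr i)) (Φ₂.toFun a) ⊆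
        branch G₂ (Φ₂.toFun (Sum.inr j)) (Φ₂.toFun c) → Φ₁.toFun a = Φ₁.toFun c := by
    intro a ha hsub
    obtain ⟨_, ⟨z, rfl⟩, hz⟩ := exists_mem_branch_of_valence hG₂ hL (Φ₂.map_adj ha)
    have z₁ := ((h₁.branch_iff h₂ hG hG₁ hG₂ hst₁ ha).2 z).2 hz
    have z₂ := ((h₁.branch_iff h₂ hG hG₁ hG₂ hst₁ hc).2 z).2 (hsub hz)
    rw [← hvert] at z₂
    have hadj := Φ₁.map_adj hc
    rw [← hvert] at hadj
    exact branch_disjoint hG₁ (Φ₁.map_adj ha) hadj z₁ z₂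
  have hab : Φ₁.toFun a = Φ₁.toFun b := (key a ha hsp).trans (key b hb hsq).symm
  obtain ⟨_, ⟨z, rfl⟩, hz⟩ := exists_mem_branch_of_valence hG₂ hL (Φ₂.map_adj ha)
  have z₁ := ((h₁.branch_iff h₂ hG hG₁ hG₂ hst₁ ha).2 z).2 hz
  rw [hab] at z₁
  have z₂ := ((h₁.branch_iff h₂ hG hG₁ hG₂ hst₁ hb).2 z).1 z₁
  exact hpq (branch_disjoint hG₂ (Φ₂.map_adj ha) (Φ₂.map_adj hb) hz z₂)

/-- A harmonic map to a given tree is determined by its values on the leaves. -/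
lemma OnLeaves.eq {Φ₁ : HarmonicMap G G₁} {Φ₂ : HarmonicMap G G₁} {f : Y → Z}
    {e : Y → ℤ} {m₁ : I → I₁} {m₂ : I → I₁} (h₁ : Φ₁.OnLeaves f e m₁) (h₂ : Φ₂.OnLeaves f e m₂)
    [Finite (Z ⊕ I₁)] (hG : G.IsTree) (hG₁ : G₁.IsTree)
    (hst : ∀ w : I₁, 3 ≤ (G₁.neighborSet (Sum.inr w)).ncard) : m₁ = m₂ := by
  funext i
  by_contra hne
  have hL : ∀ x ∉ Set.range (Sum.inl : Z → Z ⊕ I₁), 3 ≤ (G₁.neighborSet x).ncard := by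
    rintro (z | w) hx
    · exact absurd ⟨z, rfl⟩ hx
    · exact hst w
  have ei : ∀ i, Φ₁.toFun (Sum.inr i) = Sum.inr (m₁ i) := fun i => by rw [h₁.map_eq]; rfl
  have ei' : ∀ i, Φ₂.toFun (Sum.inr i) = Sum.inr (m₂ i) := fun i => by rw [h₂.map_eq]; rfl
  obtain ⟨p, q, u', hpq, hp, hq, hu, hsp, hsq⟩ := exists_two_branches_subset hG₁
    (w := Φ₁.toFun (Sum.inr i)) (w' := Φ₂.toFun (Sum.inr i))
    (by rw [ei, ei']; exact fun h => hne (Sum.inr.inj h)) (by rw [ei]; exact hst _)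
  obtain ⟨a, ha, rfl⟩ := Φ₁.exists_adj hp
  obtain ⟨b, hb, rfl⟩ := Φ₁.exists_adj hq
  obtain ⟨c, hc, rfl⟩ := Φ₂.exists_adj hu
  -- The edge to `c` has the same leaves beyond its two images. Any branch at `m₁ i` inside the
  -- second image therefore meets the first one, and equals it.
  have key : ∀ a, G.Adj (Sum.inr i) a →
      branch G₁ (Φ₁.toFun (Sum.inr i)) (Φ₁.toFun a) ⊆
        branch G₁ (Φ₂.toFun (Sum.inr i)) (Φ₂.toFun c) → Φ₁.toFun a = Φ₁.toFun c := by
    intro a ha hsub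
    obtain ⟨_, ⟨z, rfl⟩, hz⟩ := exists_mem_branch_of_valence hG₁ hL (Φ₁.map_adj ha)
    have z₂ := ((h₁.branch_iff h₂ hG hG₁ hG₁ hst hc).2 z).2 (hsub hz)
    exact branch_disjoint hG₁ (Φ₁.map_adj ha) (Φ₁.map_adj hc) hz z₂
  exact hpq ((key a ha hsp).trans (key b hb hsq).symm)

end HarmonicMap

end SphereTrees

namespace SphereTrees

open Topology

/-! ### Projective isomorphisms of spheres -/

lemma isCoveringMap_restrict_comp {S S' S'' : Type v} [TopologicalSpace S] [TopologicalSpace S']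
    [TopologicalSpace S''] {f : S' → S''} {μ : S ≃ₜ S'} {A : Set S} {B : Set S'}
    {D : Set S''} (hAB : ∀ s, s ∈ A ↔ μ s ∈ B) (hf : Set.MapsTo f B D)
    (hcov : IsCoveringMap hf.restrict) (h : Set.MapsTo (f ∘ μ) A D) : IsCoveringMap h.restrict :=
  hcov.comp_homeomorph (μ.subtype hAB)

lemma isCoveringMap_restrict_id {S : Type v} [TopologicalSpace S] (A : Set S) :
    IsCoveringMap (Set.mapsTo_id A).restrict :=
  fun _ => IsEvenlyCovered.to_isEvenlyCovered_preimage (I := Unit)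
    ⟨inferInstance, Set.univ, trivial, isOpen_univ, isOpen_univ,
      (Homeomorph.prodPUnit (Set.univ : Set A)).symm, fun _ => rfl⟩

section ProjectiveIso

variable {S S' S'' : Type v} [TopologicalSpace S] [TopologicalSpace S'] [TopologicalSpace S'']
  [ProjectiveStructure S] [ProjectiveStructure S'] [ProjectiveStructure S'']

/-- A homeomorphism is projective if it pulls projective charts back to projective charts. -/
def IsProjective (μ : S ≃ₜ S') : Prop := ∀ τ ∈ charts S', μ.trans τ ∈ charts S

lemma isProjective_of_mem {μ : S ≃ₜ S'} {τ : S' ≃ₜ OnePoint ℂ} (hτ : τ ∈ charts S')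
    (h : μ.trans τ ∈ charts S) : IsProjective μ := by
  intro τ' hτ'
  obtain ⟨g, hg⟩ := (ProjectiveStructure.mem_iff τ hτ τ').1 hτ'
  exact (ProjectiveStructure.mem_iff _ h _).2 ⟨g, fun s => hg (μ s)⟩

lemma isProjective_refl : IsProjective (Homeomorph.refl S) := fun _ hτ => hτ

lemma IsProjective.trans {μ : S ≃ₜ S'} {ν : S' ≃ₜ S''} (hμ : IsProjective μ)
    (hν : IsProjective ν) : IsProjective (μ.trans ν) := fun τ hτ => hμ _ (hν τ hτ)

lemma IsProjective.symm {μ : S ≃ₜ S'} (hμ : IsProjective μ) : IsProjective μ.symm := by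
  obtain ⟨τ, hτ⟩ := ProjectiveStructure.nonempty (S := S')
  refine isProjective_of_mem (hμ τ hτ) ?_
  convert hτ using 1
  ext s
  simp

lemma isProjective_trans_symm {σ : S ≃ₜ OnePoint ℂ} {τ : S' ≃ₜ OnePoint ℂ} (hσ : σ ∈ charts S)
    (hτ : τ ∈ charts S') : IsProjective (σ.trans τ.symm) := by
  refine isProjective_of_mem hτ ?_
  convert hσ using 1
  ext s
  simp

lemma IsHolomorphic.comp_projective {f : S' → S''} (hf : IsHolomorphic f) {μ : S ≃ₜ S'}
    (hμ : IsProjective μ) : IsHolomorphic (f ∘ μ) :=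
  ⟨hf.1.comp μ.continuous, fun σ hσ τ hτ z hz => hf.2 (μ.symm.trans σ) (hμ.symm σ hσ) τ hτ z hz⟩

lemma IsRamifiedCover.comp_projective {f : S' → S''} (hf : IsRamifiedCover f) {μ : S ≃ₜ S'}
    (hμ : IsProjective μ) : IsRamifiedCover (f ∘ μ) := by
  obtain ⟨s, t, hst⟩ := hf.2
  exact ⟨hf.1.comp_projective hμ, μ.symm s, μ.symm t, by simpa using hst⟩

lemma localDegree_comp_projective (f : S' → S'') {μ : S ≃ₜ S'} (hμ : IsProjective μ) (s : S) :
    localDegree (f ∘ μ) s = localDegree f (μ s) := by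
  unfold localDegree
  congr 1
  ext n
  constructor
  · rintro ⟨σ, hσ, τ, hτ, h1, h2, h3⟩
    exact ⟨μ.symm.trans σ, hμ.symm σ hσ, τ, hτ, by simpa using h1, h2, h3⟩
  · rintro ⟨σ, hσ, τ, hτ, h1, h2, rfl⟩
    refine ⟨μ.trans σ, hμ σ hσ, τ, hτ, h1, h2, ?_⟩
    congr 1
    ext z
    simp [inCharts_apply, Homeomorph.symm_trans_apply]

variable (S) in
lemma isRamifiedCover_id : IsRamifiedCover (id : S → S) := by
  have := infinite_of_projectiveStructure S
  obtain ⟨s, t, hst⟩ := exists_pair_ne S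
  exact ⟨⟨continuous_id, fun σ hσ τ hτ z hz => (chart_change hσ hτ hz).1⟩, s, t, hst⟩

lemma localDegree_id (s : S) : localDegree (id : S → S) s = 1 := by
  obtain ⟨σ, hσ, hs⟩ := exists_chart_zero s
  have e : s = σ.symm ((0 : ℂ) : OnePoint ℂ) := by rw [← hs, σ.symm_apply_apply]
  have hid : inCharts σ σ id = id := by
    ext z
    simp [inCharts_apply]
  rw [e, localDegree_eq_analyticOrderNatAt (isRamifiedCover_id S).1 hσ hσ (by simp), hid]
  simp [analyticOrderNatAt]

lemma IsProjective.isRamifiedCover {μ : S ≃ₜ S'} (hμ : IsProjective μ) : IsRamifiedCover μ :=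
  (isRamifiedCover_id S').comp_projective hμ

lemma IsProjective.localDegree_eq_one {μ : S ≃ₜ S'} (hμ : IsProjective μ) (s : S) :
    localDegree μ s = 1 :=
  (localDegree_comp_projective id hμ s).trans (localDegree_id _)

/-- A bijective ramified cover whose local degrees are `1` is projective. -/
lemma IsRamifiedCover.exists_projective {f : S → S'} (hf : IsRamifiedCover f)
    (hbij : Function.Bijective f) (hdeg : ∀ s, localDegree f s = 1) :
    ∃ μ : S ≃ₜ S', IsProjective μ ∧ ⇑μ = f := by
  classical
  have := compactSpace_of_projectiveStructure S
  have := t2Space_of_projectiveStructure S'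
  have := infinite_of_projectiveStructure S
  let μ : S ≃ₜ S' := Continuous.homeoOfEquivCompactToT2 (f := Equiv.ofBijective f hbij) hf.1.1
  have hμ : ⇑μ = f := rfl
  obtain ⟨F, hF⟩ := Infinite.exists_subset_card_eq S 3
  obtain ⟨a, b, c, hab, hac, hbc, -⟩ := Finset.card_eq_three.1 hF
  obtain ⟨σ, hσ, ha, hb, hc⟩ := exists_chart_zero_infty_one hab hac hbc
  obtain ⟨τ, hτ, ha', hb', hc'⟩ := exists_chart_zero_infty_one (hbij.1.ne hab) (hbij.1.ne hac)
    (hbij.1.ne hbc)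
  -- Compared with the identity: with three points normalised, `f` in charts is the identity, so it
  -- pulls `τ` back to `σ`.
  have key := hf.eq_of_fibres (isRamifiedCover_id S) hτ hσ
    (fun s => by
      rw [← ha', τ.injective.eq_iff, hbij.1.eq_iff, ha', ← ha, id, σ.injective.eq_iff])
    (fun s => by
      rw [← hb', τ.injective.eq_iff, hbij.1.eq_iff, hb', ← hb, id, σ.injective.eq_iff])
    (fun s _ => by rw [hdeg, localDegree_id]) (fun s _ => by rw [hdeg, localDegree_id]) hc' hc
  refine ⟨μ, isProjective_of_mem hτ ?_, hμ⟩
  convert hσ using 1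
  ext s
  exact key s

end ProjectiveIso

/-! ### Covers between trees of spheres -/

section Trees

variable {Y : Type u} {Z : Type u'}

lemma TreeOfSpheres.finite_vertices [Finite Y] (T : TreeOfSpheres.{u, v} Y) :
    Finite (Y ⊕ T.IV) := by
  have := T.finite_IV
  infer_instance

/-- Stated in the sigma type because points of spheres at propositionally equal vertices have
different types. -/
lemma TreeOfSpheres.attach_congr (T : TreeOfSpheres.{u, v} Y) {w w' : T.IV} {a a' : Y ⊕ T.IV}
    (hw : w = w') (ha : a = a') (h : T.graph.Adj (Sum.inr w) a)
    (h' : T.graph.Adj (Sum.inr w') a') :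
    (⟨w, T.attach w ⟨a, h⟩⟩ : Σ w, T.Sphere w) = ⟨w', T.attach w' ⟨a', h'⟩⟩ := by
  subst hw ha
  rfl

lemma TreeOfSpheres.attach_congr_right (T : TreeOfSpheres.{u, v} Y) {w : T.IV} {a a' : Y ⊕ T.IV}
    (ha : a = a') (h : T.graph.Adj (Sum.inr w) a) (h' : T.graph.Adj (Sum.inr w) a') :
    T.attach w ⟨a, h⟩ = T.attach w ⟨a', h'⟩ := by
  subst ha
  rfl

lemma TreeOfSpheres.attach_inj (T : TreeOfSpheres.{u, v} Y) {w : T.IV} {a a' : Y ⊕ T.IV}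
    {h : T.graph.Adj (Sum.inr w) a} {h' : T.graph.Adj (Sum.inr w) a'} :
    T.attach w ⟨a, h⟩ = T.attach w ⟨a', h'⟩ ↔ a = a' :=
  ⟨fun e => congrArg Subtype.val (T.attach_injective w e), fun e => T.attach_congr_right e h h'⟩

lemma TreeOfSpheres.exists_adj (T : TreeOfSpheres.{u, v} Y) (w : T.IV) :
    ∃ a, T.graph.Adj (Sum.inr w) a := by
  have h := T.stable w
  exact Set.nonempty_of_ncard_ne_zero (s := T.graph.neighborSet (Sum.inr w)) (by omega)

/-- Two adjacent leaves would form the whole connected tree, leaving room for two marked points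
only. -/
lemma TreeOfSpheres.not_adj_inl_inl [Fintype Y] (hY : 3 ≤ Fintype.card Y)
    (T : TreeOfSpheres.{u, v} Y) (y y' : Y) : ¬ T.graph.Adj (Sum.inl y) (Sum.inl y') := by
  classical
  intro h
  have huniq : ∀ {y y' : Y} {b : Y ⊕ T.IV}, T.graph.Adj (Sum.inl y) (Sum.inl y') →
      T.graph.Adj (Sum.inl y) b → b = Sum.inl y' := by
    intro y y' b h1 h2
    obtain ⟨c, hc⟩ := Set.ncard_eq_one.1 (T.leaf y)
    have e1 : Sum.inl y' ∈ T.graph.neighborSet (Sum.inl y) := h1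
    have e2 : b ∈ T.graph.neighborSet (Sum.inl y) := h2
    rw [hc, Set.mem_singleton_iff] at e1 e2
    rw [e1, e2]
  have key := connected_induction T.isTree.connected (a := Sum.inl y)
    (p := fun x => x = Sum.inl y ∨ x = Sum.inl y') (Or.inl rfl) (by
      rintro a b hab (rfl | rfl)
      · exact Or.inr (huniq h hab)
      · exact Or.inl (huniq h.symm hab))
  have hsub : (Finset.univ : Finset Y) ⊆ {y, y'} := by
    intro x _
    rcases key (Sum.inl x) with e | e <;> simp [Sum.inl.inj e]
  have := (Finset.card_le_card hsub).trans Finset.card_le_two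
  rw [Finset.card_univ] at this
  omega

/-! ### Fibres of a cover over attaching points -/

namespace TreeCover

variable {T : TreeOfSpheres.{u, v} Y} {T' : TreeOfSpheres.{u', v} Z} (C : TreeCover T T')

/-- The map induced on the vertices of the combinatorial trees. -/
abbrev treeMap : Y ⊕ T.IV → Z ⊕ T'.IV := Sum.map C.leafMap C.vertMap

/-- Points that are not attaching points map to points that are not, so the fibre over an attaching
point is read off the tree. -/
lemma sphereMap_eq_attach_iff {w : T.IV} {s : T.Sphere w} {u : Z ⊕ T'.IV}
    (hu : T'.graph.Adj (Sum.inr (C.vertMap w)) u) :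
    C.sphereMap w s = T'.attach (C.vertMap w) ⟨u, hu⟩ ↔
      ∃ (a : Y ⊕ T.IV) (h : T.graph.Adj (Sum.inr w) a), T.attach w ⟨a, h⟩ = s ∧
        C.treeMap a = u := by
  constructor
  · intro hs
    have hmem : s ∈ Set.range (T.attach w) := by
      by_contra hcon
      exact C.mapsTo w hcon (hs ▸ Set.mem_range_self _)
    obtain ⟨⟨a, h⟩, rfl⟩ := hmem
    refine ⟨a, h, rfl, ?_⟩
    exact T'.attach_inj.1 ((C.sphereMap_attach w a h).symm.trans hs)
  · rintro ⟨a, h, rfl, rfl⟩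
    exact C.sphereMap_attach w a h

lemma finite_fibre [Finite Y] {w : T.IV} {u : Z ⊕ T'.IV}
    (hu : T'.graph.Adj (Sum.inr (C.vertMap w)) u) :
    {s | C.sphereMap w s = T'.attach (C.vertMap w) ⟨u, hu⟩}.Finite := by
  have := T.finite_vertices
  refine (Set.finite_range (T.attach w)).subset fun s hs => ?_
  obtain ⟨a, h, rfl, -⟩ := (C.sphereMap_eq_attach_iff hu).1 hs
  exact Set.mem_range_self _

/-- A missed point would have an empty fibre of degree `0`, against the positive degree over the
image of an attaching point. -/
lemma sphereMap_surjective [Finite Y] (w : T.IV) : Function.Surjective (C.sphereMap w) := by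
  intro q
  by_contra hcon
  rw [not_exists] at hcon
  obtain ⟨a, ha⟩ := T.exists_adj w
  have hq : q ≠ T'.attach (C.vertMap w) ⟨C.treeMap a, C.map_adj ha⟩ := by
    rintro rfl
    exact hcon _ (C.sphereMap_attach w a ha)
  have hsum := (C.ramifiedCover w).sum_localDegree_eq hq (A := ∅)
    (B := (C.finite_fibre (C.map_adj ha)).toFinset) (fun s => by simpa using hcon s)
    (fun s => by rw [Set.Finite.mem_toFinset]; rfl)
  rw [Finset.sum_empty] at hsum
  have := Finset.sum_eq_zero_iff.1 hsum.symm (T.attach w ⟨a, ha⟩) (by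
    rw [Set.Finite.mem_toFinset]
    exact C.sphereMap_attach w a ha)
  exact ((C.ramifiedCover w).localDegree_pos _).ne' this

lemma exists_adj_of_adj [Finite Y] {w : T.IV} {u : Z ⊕ T'.IV}
    (hu : T'.graph.Adj (Sum.inr (C.vertMap w)) u) :
    ∃ a, T.graph.Adj (Sum.inr w) a ∧ C.treeMap a = u := by
  obtain ⟨s, hs⟩ := C.sphereMap_surjective w (T'.attach (C.vertMap w) ⟨u, hu⟩)
  obtain ⟨a, h, -, e⟩ := (C.sphereMap_eq_attach_iff hu).1 hs
  exact ⟨a, h, e⟩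

lemma exists_total_eq [Finite Y] {w : T.IV} {q : Σ w, T'.Sphere w} (hq : C.vertMap w = q.1) :
    ∃ s, C.total ⟨w, s⟩ = q := by
  obtain ⟨w', x⟩ := q
  obtain rfl : C.vertMap w = w' := hq
  obtain ⟨s, rfl⟩ := C.sphereMap_surjective w x
  exact ⟨s, rfl⟩

lemma eq_of_total_eq {C₁ C₂ : TreeCover T T'} (hl : C₁.leafMap = C₂.leafMap)
    (hv : C₁.vertMap = C₂.vertMap) (ht : ∀ p, C₁.total p = C₂.total p) : C₁ = C₂ := by
  obtain ⟨l₁, v₁, _, s₁, _, _, _, _, _⟩ := C₁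
  obtain ⟨l₂, v₂, _, s₂, _, _, _, _, _⟩ := C₂
  obtain rfl : l₁ = l₂ := hl
  obtain rfl : v₁ = v₂ := hv
  obtain rfl : s₁ = s₂ := by
    funext w s
    exact eq_of_heq (Sigma.mk.inj (ht ⟨w, s⟩)).2
  rfl

end TreeCover

/-! ### Isomorphisms of trees of spheres -/

/-- An isomorphism of trees of spheres marked by the same set, described by its bijection between
internal vertices and its projective isomorphisms between spheres. -/
structure TreeEquiv (T T' : TreeOfSpheres.{u, v} Y) where
  vert : T.IV ≃ T'.IV
  adj_iff : ∀ {a b : Y ⊕ T.IV},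
    T'.graph.Adj (Sum.map id vert a) (Sum.map id vert b) ↔ T.graph.Adj a b
  sphere : ∀ w, T.Sphere w ≃ₜ T'.Sphere (vert w)
  projective : ∀ w, IsProjective (sphere w)
  sphere_attach : ∀ (w : T.IV) (a : Y ⊕ T.IV) (h : T.graph.Adj (Sum.inr w) a),
    sphere w (T.attach w ⟨a, h⟩) = T'.attach (vert w) ⟨Sum.map id vert a, adj_iff.2 h⟩

namespace TreeEquiv

variable {T T' T'' : TreeOfSpheres.{u, v} Y}

lemma mem_range_attach_iff (E : TreeEquiv T T') (w : T.IV) (s : T.Sphere w) :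
    s ∈ Set.range (T.attach w) ↔ E.sphere w s ∈ Set.range (T'.attach (E.vert w)) := by
  constructor
  · rintro ⟨⟨a, h⟩, rfl⟩
    exact ⟨_, (E.sphere_attach w a h).symm⟩
  · rintro ⟨⟨b, h⟩, hb⟩
    obtain ⟨a, rfl⟩ := (Equiv.sumCongr (Equiv.refl Y) E.vert).surjective b
    have h' : T.graph.Adj (Sum.inr w) a := E.adj_iff.1 h
    exact ⟨⟨a, h'⟩, (E.sphere w).injective ((E.sphere_attach w a h').trans hb)⟩

/-- A tree isomorphism as a cover. -/
def toCover (E : TreeEquiv T T') : TreeCover T T' where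
  leafMap := id
  vertMap := E.vert
  map_adj h := E.adj_iff.2 h
  sphereMap w := E.sphere w
  ramifiedCover w := (E.projective w).isRamifiedCover
  mapsTo w s hs h := hs ((E.mem_range_attach_iff w s).2 h)
  isCoveringMap w := isCoveringMap_restrict_comp (f := id) (μ := E.sphere w)
    (fun s => not_congr (E.mem_range_attach_iff w s)) (Set.mapsTo_id _)
    (isCoveringMap_restrict_id _) _
  sphereMap_attach w a h := E.sphere_attach w a h
  localDegree_eq w₁ w₂ h := by
    rw [(E.projective w₁).localDegree_eq_one, (E.projective w₂).localDegree_eq_one]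

lemma toCover_isIso (E : TreeEquiv T T') : E.toCover.IsIso := by
  refine ⟨fun q => ?_, fun _ => rfl⟩
  obtain ⟨w', x⟩ := q
  obtain ⟨w, rfl⟩ := E.vert.surjective w'
  obtain ⟨s, rfl⟩ := (E.sphere w).surjective x
  have hfib : E.toCover.total ⁻¹' {⟨E.vert w, E.sphere w s⟩} = {⟨w, s⟩} := by
    ext ⟨w₁, s₁⟩
    simp only [Set.mem_preimage, Set.mem_singleton_iff]
    constructor
    · intro h
      obtain rfl : w₁ = w := E.vert.injective (congrArg Sigma.fst h)
      exact congrArg (Sigma.mk w₁) ((E.sphere w₁).injective (eq_of_heq (Sigma.mk.inj h).2))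
    · intro h
      rw [h]
      rfl
  rw [hfib, finsum_mem_singleton]
  exact (E.projective w).localDegree_eq_one s

/-- The composition of a tree isomorphism with a cover. -/
def comp {R : TreeOfSpheres.{u', v} Z} (E : TreeEquiv T T') (C : TreeCover T' R) :
    TreeCover T R where
  leafMap := C.leafMap
  vertMap := C.vertMap ∘ E.vert
  map_adj h := by
    have := C.map_adj (E.adj_iff.2 h)
    rwa [Sum.map_map, Sum.map_map] at this
  sphereMap w := C.sphereMap (E.vert w) ∘ E.sphere w
  ramifiedCover w := (C.ramifiedCover (E.vert w)).comp_projective (E.projective w)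
  mapsTo w s hs := C.mapsTo (E.vert w) fun h => hs ((E.mem_range_attach_iff w s).2 h)
  isCoveringMap w := isCoveringMap_restrict_comp
    (fun s => not_congr (E.mem_range_attach_iff w s)) (C.mapsTo (E.vert w))
    (C.isCoveringMap (E.vert w)) _
  sphereMap_attach w a h :=
    (congrArg (C.sphereMap (E.vert w)) (E.sphere_attach w a h)).trans
      ((C.sphereMap_attach _ _ _).trans
        (R.attach_congr_right (by rw [Sum.map_map, Function.comp_id]) _ _))
  localDegree_eq w₁ w₂ h := by
    rw [localDegree_comp_projective _ (E.projective w₁),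
      localDegree_comp_projective _ (E.projective w₂), E.sphere_attach, E.sphere_attach]
    exact C.localDegree_eq (E.vert w₁) (E.vert w₂) (E.adj_iff.2 h)

/-- The identity. -/
def refl (T : TreeOfSpheres.{u, v} Y) : TreeEquiv T T where
  vert := Equiv.refl _
  adj_iff := by simp
  sphere w := Homeomorph.refl _
  projective w := isProjective_refl
  sphere_attach w a h := T.attach_congr_right (by simp) _ _

/-- The composition of tree isomorphisms. -/
def trans (E : TreeEquiv T T') (E' : TreeEquiv T' T'') : TreeEquiv T T'' where
  vert := E.vert.trans E'.vert
  adj_iff {a b} := by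
    rw [← E.adj_iff, ← E'.adj_iff, Sum.map_map, Sum.map_map]
    rfl
  sphere w := (E.sphere w).trans (E'.sphere (E.vert w))
  projective w := (E.projective w).trans (E'.projective _)
  sphere_attach w a h :=
    (congrArg (E'.sphere (E.vert w)) (E.sphere_attach w a h)).trans
      ((E'.sphere_attach _ _ _).trans
        (T''.attach_congr_right (by rw [Sum.map_map]; rfl) _ _))

lemma exists_symm_sphere (E : TreeEquiv T T') (w' : T'.IV) :
    ∃ μ : T'.Sphere w' ≃ₜ T.Sphere (E.vert.symm w'), IsProjective μ ∧
      ∀ (a : Y ⊕ T'.IV) (h : T'.graph.Adj (Sum.inr w') a)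
        (h' : T.graph.Adj (Sum.inr (E.vert.symm w')) (Sum.map id E.vert.symm a)),
        μ (T'.attach w' ⟨a, h⟩) = T.attach (E.vert.symm w') ⟨Sum.map id E.vert.symm a, h'⟩ := by
  obtain ⟨w, rfl⟩ := E.vert.surjective w'
  -- The spheres at `E.vert.symm (E.vert w)` and at `w` have different types; generalising the
  -- vertex permits the substitution.
  generalize hk : E.vert.symm (E.vert w) = k
  rw [E.vert.symm_apply_apply] at hk
  subst hk
  refine ⟨(E.sphere w).symm, (E.projective w).symm, fun a h h' => ?_⟩
  rw [Homeomorph.symm_apply_eq, E.sphere_attach]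
  refine T'.attach_congr_right ?_ _ _
  rw [Sum.map_map]
  simp

lemma nonempty_symm (E : TreeEquiv T T') : Nonempty (TreeEquiv T' T) := by
  choose μ hμ hμ' using E.exists_symm_sphere
  have hadj : ∀ {a b : Y ⊕ T'.IV}, T.graph.Adj (Sum.map id E.vert.symm a)
      (Sum.map id E.vert.symm b) ↔ T'.graph.Adj a b := by
    intro a b
    rw [← E.adj_iff, Sum.map_map, Sum.map_map]
    simp
  exact ⟨⟨E.vert.symm, hadj, μ, hμ, fun w a h => hμ' w a h (hadj.2 h)⟩⟩

end TreeEquiv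

lemma exists_eq_singleton_of_finsum_eq_one {α : Type*} {A : Set α} {g : α → ℕ}
    (hg : ∀ p ∈ A, 0 < g p) (h : ∑ᶠ p ∈ A, g p = 1) : ∃ p, A = {p} ∧ g p = 1 := by
  have hA : A ∩ Function.support g = A :=
    Set.inter_eq_left.2 fun p hp => (hg p hp).ne'
  have hfin : A.Finite := by
    by_contra hcon
    -- A `finsum` with infinite support is `0` by default, so the value `1` forces finiteness.
    rw [finsum_mem_eq_zero_of_infinite (by rwa [hA])] at h
    exact zero_ne_one h
  rw [finsum_mem_eq_finite_toFinset_sum g hfin] at h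
  have hcard : hfin.toFinset.card ≤ 1 := by
    rw [← h, Finset.card_eq_sum_ones]
    exact Finset.sum_le_sum fun p hp => hg p (hfin.mem_toFinset.1 hp)
  have hne : hfin.toFinset.card ≠ 0 := by
    intro h0
    rw [Finset.card_eq_zero.1 h0, Finset.sum_empty] at h
    exact zero_ne_one h
  obtain ⟨p, hp⟩ := Finset.card_eq_one.1 (le_antisymm hcard (Nat.pos_of_ne_zero hne))
  rw [hp, Finset.sum_singleton] at h
  refine ⟨p, ?_, h⟩
  rw [← hfin.coe_toFinset, hp, Finset.coe_singleton]

/-- Covers of degree `1` are isomorphisms. -/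
lemma TreeCover.IsIso.nonempty_treeEquiv [Fintype Y] (hY : 3 ≤ Fintype.card Y)
    {T T' : TreeOfSpheres.{u, v} Y} {M : TreeCover T T'} (hM : M.IsIso) :
    Nonempty (TreeEquiv T T') := by
  have hleaf : M.leafMap = id := funext hM.2
  have hfib : ∀ q, ∃ p, M.total ⁻¹' {q} = {p} ∧ localDegree (M.sphereMap p.1) p.2 = 1 := fun q =>
    exists_eq_singleton_of_finsum_eq_one
      (fun p _ => (M.ramifiedCover p.1).localDegree_pos p.2) (hM.1 q)
  have hinj : Function.Injective M.total := by
    intro p p' h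
    obtain ⟨p₀, hp₀, -⟩ := hfib (M.total p')
    have e : p ∈ M.total ⁻¹' {M.total p'} := h
    have e' : p' ∈ M.total ⁻¹' {M.total p'} := rfl
    rw [hp₀, Set.mem_singleton_iff] at e e'
    rw [e, e']
  have hdeg : ∀ w s, localDegree (M.sphereMap w) s = 1 := by
    intro w s
    obtain ⟨p₀, hp₀, h⟩ := hfib (M.total ⟨w, s⟩)
    have e : (⟨w, s⟩ : Σ w, T.Sphere w) ∈ M.total ⁻¹' {M.total ⟨w, s⟩} := rfl
    rw [hp₀, Set.mem_singleton_iff] at e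
    subst e
    exact h
  have hvert : Function.Bijective M.vertMap := by
    constructor
    · intro w₁ w₂ h
      have := infinite_of_projectiveStructure (T.Sphere w₁)
      obtain ⟨s⟩ : Nonempty (T.Sphere w₁) := inferInstance
      -- Both sphere maps are onto, so two vertices with one image would give a point two preimages.
      obtain ⟨t, ht⟩ := M.exists_total_eq (w := w₂) (q := M.total ⟨w₁, s⟩) h.symm
      exact congrArg Sigma.fst (hinj ht).symm
    · intro w'
      have := infinite_of_projectiveStructure (T'.Sphere w')
      obtain ⟨x⟩ : Nonempty (T'.Sphere w') := inferInstance
      obtain ⟨p, hp, -⟩ := hfib ⟨w', x⟩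
      have e : M.total p = ⟨w', x⟩ := by
        have : p ∈ M.total ⁻¹' {⟨w', x⟩} := by rw [hp]; rfl
        exact this
      exact ⟨p.1, congrArg Sigma.fst e⟩
  have hsphere : ∀ w, ∃ μ : T.Sphere w ≃ₜ T'.Sphere (M.vertMap w), IsProjective μ ∧
      ⇑μ = M.sphereMap w := fun w => by
    refine (M.ramifiedCover w).exists_projective ⟨fun s t hst => ?_, M.sphereMap_surjective w⟩
      (hdeg w)
    have : M.total ⟨w, s⟩ = M.total ⟨w, t⟩ := by
      change (⟨_, M.sphereMap w s⟩ : Σ w, T'.Sphere w) = ⟨_, M.sphereMap w t⟩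
      rw [hst]
    exact eq_of_heq (Sigma.mk.inj (hinj this)).2
  choose μ hμ hμM using hsphere
  have htree : ∀ a, M.treeMap a = Sum.map id M.vertMap a := fun a => by
    rw [TreeCover.treeMap, hleaf]
  have htinj : Function.Injective M.treeMap := by
    rw [TreeCover.treeMap, hleaf]
    exact Sum.map_injective.2 ⟨Function.injective_id, hvert.1⟩
  have hback : ∀ {w : T.IV} {b : Y ⊕ T.IV}, T'.graph.Adj (M.treeMap (Sum.inr w)) (M.treeMap b) →
      T.graph.Adj (Sum.inr w) b := by
    intro w b h
    obtain ⟨b', hb', e⟩ := M.exists_adj_of_adj h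
    rwa [← htinj e]
  have hadj : ∀ {a b : Y ⊕ T.IV}, T'.graph.Adj (M.treeMap a) (M.treeMap b) ↔
      T.graph.Adj a b := by
    intro a b
    -- A target edge with an internal end lifts to the source, and injectivity identifies the other
    -- end of the lift; edges between two leaves do not exist.
    refine ⟨fun h => ?_, fun h => M.map_adj h⟩
    cases a with
    | inr w => exact hback h
    | inl y =>
      cases b with
      | inr w => exact (hback h.symm).symm
      | inl y' => exact absurd h (T'.not_adj_inl_inl hY _ _)
  refine ⟨⟨Equiv.ofBijective _ hvert, fun {a b} => ?_, μ, hμ, fun w a h => ?_⟩⟩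
  · change T'.graph.Adj (Sum.map id M.vertMap a) (Sum.map id M.vertMap b) ↔ _
    rw [← htree, ← htree]
    exact hadj
  · exact (congrFun (hμM w) _).trans
      ((M.sphereMap_attach w a h).trans (T'.attach_congr_right (htree a) _ _))

lemma treeIso_iff_nonempty [Fintype Y] (hY : 3 ≤ Fintype.card Y)
    (T T' : TreeOfSpheres.{u, v} Y) : TreeIso T T' ↔ Nonempty (TreeEquiv T T') :=
  ⟨fun ⟨_, hM⟩ => hM.nonempty_treeEquiv hY, fun ⟨E⟩ => ⟨E.toCover, E.toCover_isIso⟩⟩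

lemma treeIso_equivalence [Fintype Y] (hY : 3 ≤ Fintype.card Y) :
    Equivalence (TreeIso : TreeOfSpheres.{u, v} Y → TreeOfSpheres.{u, v} Y → Prop) where
  refl T := (treeIso_iff_nonempty hY T T).2 ⟨TreeEquiv.refl T⟩
  symm h := by
    rw [treeIso_iff_nonempty hY] at h ⊢
    exact h.some.nonempty_symm
  trans h h' := by
    rw [treeIso_iff_nonempty hY] at h h' ⊢
    exact ⟨h.some.trans h'.some⟩

end Trees

end SphereTrees

namespace SphereTrees

/-! ### Covers as harmonic maps -/

section Harmonic

variable {Y : Type u} {Z : Type u'} {T : TreeOfSpheres.{u, v} Y} {T' : TreeOfSpheres.{u', v} Z}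

open scoped Classical in
/-- The weight of an edge for a cover: the local degree at the point where it is attached to an
internal vertex, and `e y` at a leaf `y`. -/
noncomputable def TreeCover.edgeWeight (C : TreeCover T T') (e : Y → ℤ) :
    Y ⊕ T.IV → Y ⊕ T.IV → ℤ
  | Sum.inl y, _ => e y
  | Sum.inr w, a => if h : T.graph.Adj (Sum.inr w) a then
      (localDegree (C.sphereMap w) (T.attach w ⟨a, h⟩) : ℤ) else 0

lemma TreeCover.edgeWeight_inr (C : TreeCover T T') (e : Y → ℤ) {w : T.IV} {a : Y ⊕ T.IV}
    (h : T.graph.Adj (Sum.inr w) a) :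
    C.edgeWeight e (Sum.inr w) a = localDegree (C.sphereMap w) (T.attach w ⟨a, h⟩) :=
  dif_pos h

open scoped Classical in
lemma TreeCover.sum_edgeWeight_eq [Finite Y] [Fintype (Y ⊕ T.IV)] (C : TreeCover T T') (e : Y → ℤ)
    {w : T.IV} {u : Z ⊕ T'.IV} (hu : T'.graph.Adj (Sum.inr (C.vertMap w)) u) :
    ∑ a with T.graph.Adj (Sum.inr w) a ∧ C.treeMap a = u, C.edgeWeight e (Sum.inr w) a =
      ∑ s ∈ (C.finite_fibre hu).toFinset, (localDegree (C.sphereMap w) s : ℤ) := by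
  refine Finset.sum_bij (fun a ha => T.attach w ⟨a, (Finset.mem_filter.1 ha).2.1⟩) ?_ ?_ ?_ ?_
  · intro a ha
    rw [Set.Finite.mem_toFinset]
    exact (C.sphereMap_eq_attach_iff hu).2 ⟨a, _, rfl, (Finset.mem_filter.1 ha).2.2⟩
  · intro a ha b hb h
    exact T.attach_inj.1 h
  · intro s hs
    rw [Set.Finite.mem_toFinset] at hs
    obtain ⟨a, h, rfl, e⟩ := (C.sphereMap_eq_attach_iff hu).1 hs
    exact ⟨a, Finset.mem_filter.2 ⟨Finset.mem_univ _, h, e⟩, rfl⟩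
  · intro a ha
    exact C.edgeWeight_inr e _

open scoped Classical in
lemma TreeCover.sum_edgeWeight_eq_of_adj [Finite Y] [Fintype (Y ⊕ T.IV)] (C : TreeCover T T')
    (e : Y → ℤ) {w : T.IV} {u u' : Z ⊕ T'.IV} (hu : T'.graph.Adj (Sum.inr (C.vertMap w)) u)
    (hu' : T'.graph.Adj (Sum.inr (C.vertMap w)) u') :
    ∑ a with T.graph.Adj (Sum.inr w) a ∧ C.treeMap a = u, C.edgeWeight e (Sum.inr w) a =
      ∑ a with T.graph.Adj (Sum.inr w) a ∧ C.treeMap a = u', C.edgeWeight e (Sum.inr w) a := by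
  by_cases h : u = u'
  · rw [h]
  · rw [C.sum_edgeWeight_eq e hu, C.sum_edgeWeight_eq e hu']
    have := (C.ramifiedCover w).sum_localDegree_eq (fun h' => h (T'.attach_inj.1 h'))
      (A := (C.finite_fibre hu).toFinset) (B := (C.finite_fibre hu').toFinset)
      (fun s => by rw [Set.Finite.mem_toFinset]; rfl)
      (fun s => by rw [Set.Finite.mem_toFinset]; rfl)
    exact_mod_cast this

variable [Fintype Y] [DecidableEq Z] {d : ℕ}

open scoped Classical in
-- Harmonicity at an internal vertex is the constancy of the degree of its sphere map; the portrait
-- supplies the weights of edges seen from leaves.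
lemma TreeCover.HasPortrait.exists_harmonicMap (hY : 3 ≤ Fintype.card Y) [Fintype (Y ⊕ T.IV)]
    {C : TreeCover T T'} {P : Portrait Y Z d} (hC : C.HasPortrait P) :
    ∃ Φ : HarmonicMap T.graph T'.graph, Φ.OnLeaves P.map (fun y => (P.deg y : ℤ)) C.vertMap ∧
      ∀ (w : T.IV) (a : Y ⊕ T.IV) (h : T.graph.Adj (Sum.inr w) a),
        Φ.weight (Sum.inr w) a = localDegree (C.sphereMap w) (T.attach w ⟨a, h⟩) := by
  set e : Y → ℤ := fun y => (P.deg y : ℤ)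
  have hpos : ∀ {x y}, T.graph.Adj x y → 0 < C.edgeWeight e x y := by
    intro x y hxy
    cases x with
    | inl x => exact Int.natCast_pos.2 (P.deg_pos x)
    | inr w =>
      rw [C.edgeWeight_inr e hxy]
      exact_mod_cast (C.ramifiedCover w).localDegree_pos _
  choose a₀ ha₀ using T.exists_adj
  -- The degree of an internal vertex is measured over the image of one chosen edge; the choice is
  -- immaterial by `sum_edgeWeight_eq_of_adj`.
  let deg : Y ⊕ T.IV → ℤ := fun x => Sum.elim e (fun w =>
    ∑ a with T.graph.Adj (Sum.inr w) a ∧ C.treeMap a = C.treeMap (a₀ w),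
      C.edgeWeight e (Sum.inr w) a) x
  refine ⟨⟨C.treeMap, C.edgeWeight e, deg, fun h => C.map_adj h, ?_, hpos, ?_, ?_⟩,
    ⟨by rw [← hC.1], fun y => rfl⟩, fun w a h => C.edgeWeight_inr e h⟩
  · intro x y hxy
    cases x with
    | inl x =>
      cases y with
      | inl y => exact absurd hxy (T.not_adj_inl_inl hY x y)
      | inr w =>
        rw [C.edgeWeight_inr e hxy.symm, hC.2 x w hxy.symm]
        rfl
    | inr w =>
      cases y with
      | inl y =>
        rw [C.edgeWeight_inr e hxy, hC.2 y w hxy]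
        rfl
      | inr w' =>
        rw [C.edgeWeight_inr e hxy, C.edgeWeight_inr e hxy.symm, C.localDegree_eq w w' hxy]
  · intro x
    cases x with
    | inl x => exact Int.natCast_pos.2 (P.deg_pos x)
    | inr w =>
      refine Finset.sum_pos (fun a ha => hpos (Finset.mem_filter.1 ha).2.1) ⟨a₀ w, ?_⟩
      simp [ha₀ w]
  · intro x u hu
    cases x with
    | inl y =>
      -- A leaf and its image have a single edge each, so the sum has one term.
      obtain ⟨a, ha⟩ := Set.ncard_eq_one.1 (T.leaf y)
      obtain ⟨b, hb⟩ := Set.ncard_eq_one.1 (T'.leaf (C.leafMap y))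
      have hadj : ∀ x, T.graph.Adj (Sum.inl y) x ↔ x = a := fun x => by
        rw [← SimpleGraph.mem_neighborSet, ha, Set.mem_singleton_iff]
      have hadj' : ∀ x, T'.graph.Adj (Sum.inl (C.leafMap y)) x ↔ x = b := fun x => by
        rw [← SimpleGraph.mem_neighborSet, hb, Set.mem_singleton_iff]
      have hab : C.treeMap a = u :=
        ((hadj' _).1 (C.map_adj ((hadj a).2 rfl))).trans ((hadj' u).1 hu).symm
      have hfilter : (Finset.univ.filter fun x => T.graph.Adj (Sum.inl y) x ∧ C.treeMap x = u) =
          {a} := by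
        ext x
        rw [Finset.mem_filter, Finset.mem_singleton, hadj]
        constructor
        · exact fun h => h.2.1
        · rintro rfl
          exact ⟨Finset.mem_univ _, rfl, hab⟩
      have key : ∑ x with T.graph.Adj (Sum.inl y) x ∧ C.treeMap x = u,
          C.edgeWeight e (Sum.inl y) x = deg (Sum.inl y) := by
        rw [hfilter, Finset.sum_singleton]
        rfl
      convert key
    | inr w =>
      convert C.sum_edgeWeight_eq_of_adj e hu (C.map_adj (ha₀ w))
      simp only [deg, Sum.elim_inr]
      congr!

end Harmonic

/-! ### Covers with the same source and the same portrait -/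

section Rigidity

variable {Y : Type u} {Z : Type u'} {T : TreeOfSpheres.{u, v} Y}
  {T₁ T₂ : TreeOfSpheres.{u', v} Z}

/-- Two covers of the same source that are related by a bijection on the internal vertices of the
targets, and have the same local degrees at the attaching points, agree in suitable charts. -/
lemma TreeCover.chart_sphereMap_eq {C₁ : TreeCover T T₁} {C₂ : TreeCover T T₂}
    (hmap : ∀ a b, C₁.treeMap a = C₁.treeMap b ↔ C₂.treeMap a = C₂.treeMap b)
    (hdeg : ∀ (w : T.IV) (a : Y ⊕ T.IV) (h : T.graph.Adj (Sum.inr w) a),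
      localDegree (C₁.sphereMap w) (T.attach w ⟨a, h⟩) =
        localDegree (C₂.sphereMap w) (T.attach w ⟨a, h⟩))
    {w : T.IV} {a b c : Y ⊕ T.IV} (ha : T.graph.Adj (Sum.inr w) a)
    (hb : T.graph.Adj (Sum.inr w) b) (hc : T.graph.Adj (Sum.inr w) c)
    {τ₁ : T₁.Sphere (C₁.vertMap w) ≃ₜ OnePoint ℂ} (hτ₁ : τ₁ ∈ charts (T₁.Sphere (C₁.vertMap w)))
    {τ₂ : T₂.Sphere (C₂.vertMap w) ≃ₜ OnePoint ℂ} (hτ₂ : τ₂ ∈ charts (T₂.Sphere (C₂.vertMap w)))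
    (ha₁ : τ₁ (T₁.attach _ ⟨C₁.treeMap a, C₁.map_adj ha⟩) = ((0 : ℂ) : OnePoint ℂ))
    (hb₁ : τ₁ (T₁.attach _ ⟨C₁.treeMap b, C₁.map_adj hb⟩) = OnePoint.infty)
    (hc₁ : τ₁ (T₁.attach _ ⟨C₁.treeMap c, C₁.map_adj hc⟩) = ((1 : ℂ) : OnePoint ℂ))
    (ha₂ : τ₂ (T₂.attach _ ⟨C₂.treeMap a, C₂.map_adj ha⟩) = ((0 : ℂ) : OnePoint ℂ))
    (hb₂ : τ₂ (T₂.attach _ ⟨C₂.treeMap b, C₂.map_adj hb⟩) = OnePoint.infty)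
    (hc₂ : τ₂ (T₂.attach _ ⟨C₂.treeMap c, C₂.map_adj hc⟩) = ((1 : ℂ) : OnePoint ℂ))
    (s : T.Sphere w) : τ₁ (C₁.sphereMap w s) = τ₂ (C₂.sphereMap w s) := by
  have hfib : ∀ {p : OnePoint ℂ} {a : Y ⊕ T.IV} (ha : T.graph.Adj (Sum.inr w) a)
      (_ : τ₁ (T₁.attach _ ⟨C₁.treeMap a, C₁.map_adj ha⟩) = p)
      (_ : τ₂ (T₂.attach _ ⟨C₂.treeMap a, C₂.map_adj ha⟩) = p) (s : T.Sphere w),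
      (τ₁ (C₁.sphereMap w s) = p ↔ τ₂ (C₂.sphereMap w s) = p) ∧ (τ₁ (C₁.sphereMap w s) = p →
        localDegree (C₁.sphereMap w) s = localDegree (C₂.sphereMap w) s) := by
    intro p a ha h₁ h₂ s
    have i₁ : τ₁ (C₁.sphereMap w s) = p ↔ ∃ (x : Y ⊕ T.IV) (h : T.graph.Adj (Sum.inr w) x),
        T.attach w ⟨x, h⟩ = s ∧ C₁.treeMap x = C₁.treeMap a := by
      rw [← h₁, τ₁.injective.eq_iff]
      exact C₁.sphereMap_eq_attach_iff (C₁.map_adj ha)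
    have i₂ : τ₂ (C₂.sphereMap w s) = p ↔ ∃ (x : Y ⊕ T.IV) (h : T.graph.Adj (Sum.inr w) x),
        T.attach w ⟨x, h⟩ = s ∧ C₂.treeMap x = C₂.treeMap a := by
      rw [← h₂, τ₂.injective.eq_iff]
      exact C₂.sphereMap_eq_attach_iff (C₂.map_adj ha)
    rw [i₁, i₂]
    refine ⟨exists_congr fun x => exists_congr fun _ => and_congr_right fun _ => hmap x a, ?_⟩
    rintro ⟨x, hx, rfl, -⟩
    exact hdeg w x hx
  exact (C₁.ramifiedCover w).eq_of_fibres (C₂.ramifiedCover w) hτ₁ hτ₂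
    (fun s => (hfib ha ha₁ ha₂ s).1) (fun s => (hfib hb hb₁ hb₂ s).1)
    (fun s => (hfib ha ha₁ ha₂ s).2) (fun s => (hfib hb hb₁ hb₂ s).2)
    (s₀ := T.attach w ⟨c, hc⟩) (by rw [C₁.sphereMap_attach]; exact hc₁)
    (by rw [C₂.sphereMap_attach]; exact hc₂) s

/-- The version of `chart_sphereMap_eq` for charts on the spheres at vertices of the targets. -/
lemma TreeCover.total_eq_of_charts [Finite Y] {C₁ : TreeCover T T₁} {C₂ : TreeCover T T₂}
    {m : T₁.IV → T₂.IV}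
    (hm : Function.Injective m) (hmv : ∀ w, m (C₁.vertMap w) = C₂.vertMap w)
    (hml : C₁.leafMap = C₂.leafMap)
    (hdeg : ∀ (w : T.IV) (a : Y ⊕ T.IV) (h : T.graph.Adj (Sum.inr w) a),
      localDegree (C₁.sphereMap w) (T.attach w ⟨a, h⟩) =
        localDegree (C₂.sphereMap w) (T.attach w ⟨a, h⟩))
    {w₁ : T₁.IV} {w₂ : T₂.IV} (hw : m w₁ = w₂) {a b c : Z ⊕ T₁.IV}
    (ha : T₁.graph.Adj (Sum.inr w₁) a)
    (hb : T₁.graph.Adj (Sum.inr w₁) b) (hc : T₁.graph.Adj (Sum.inr w₁) c)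
    (ha' : T₂.graph.Adj (Sum.inr w₂) (Sum.map id m a))
    (hb' : T₂.graph.Adj (Sum.inr w₂) (Sum.map id m b))
    (hc' : T₂.graph.Adj (Sum.inr w₂) (Sum.map id m c))
    {τ₁ : T₁.Sphere w₁ ≃ₜ OnePoint ℂ} (hτ₁ : τ₁ ∈ charts (T₁.Sphere w₁))
    {τ₂ : T₂.Sphere w₂ ≃ₜ OnePoint ℂ} (hτ₂ : τ₂ ∈ charts (T₂.Sphere w₂))
    (ha₁ : τ₁ (T₁.attach _ ⟨a, ha⟩) = ((0 : ℂ) : OnePoint ℂ))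
    (hb₁ : τ₁ (T₁.attach _ ⟨b, hb⟩) = OnePoint.infty)
    (hc₁ : τ₁ (T₁.attach _ ⟨c, hc⟩) = ((1 : ℂ) : OnePoint ℂ))
    (ha₂ : τ₂ (T₂.attach _ ⟨_, ha'⟩) = ((0 : ℂ) : OnePoint ℂ))
    (hb₂ : τ₂ (T₂.attach _ ⟨_, hb'⟩) = OnePoint.infty)
    (hc₂ : τ₂ (T₂.attach _ ⟨_, hc'⟩) = ((1 : ℂ) : OnePoint ℂ))
    (p : Σ w, T.Sphere w) (x : T₁.Sphere w₁) (hx : ⟨w₁, x⟩ = C₁.total p) :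
    ⟨w₂, τ₂.symm (τ₁ x)⟩ = C₂.total p := by
  obtain ⟨w, s⟩ := p
  obtain rfl : w₁ = C₁.vertMap w := congrArg Sigma.fst hx
  obtain rfl : x = C₁.sphereMap w s := eq_of_heq (Sigma.mk.inj hx).2
  obtain rfl : w₂ = C₂.vertMap w := hw.symm.trans (hmv w)
  have htree : ∀ a, C₂.treeMap a = Sum.map id m (C₁.treeMap a) := by
    intro a
    cases a with
    | inl y => simp [hml]
    | inr v => simp [hmv]
  have hinj : Function.Injective (Sum.map id m : Z ⊕ T₁.IV → Z ⊕ T₂.IV) :=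
    Sum.map_injective.2 ⟨Function.injective_id, hm⟩
  obtain ⟨a, haw, rfl⟩ := C₁.exists_adj_of_adj ha
  obtain ⟨b, hbw, rfl⟩ := C₁.exists_adj_of_adj hb
  obtain ⟨c, hcw, rfl⟩ := C₁.exists_adj_of_adj hc
  have key := TreeCover.chart_sphereMap_eq (C₁ := C₁) (C₂ := C₂)
    (fun a b => by rw [htree, htree, hinj.eq_iff]) hdeg haw hbw hcw hτ₁ hτ₂ ha₁ hb₁ hc₁
    ((congrArg τ₂ (T₂.attach_congr_right (htree a) _ _)).trans ha₂)
    ((congrArg τ₂ (T₂.attach_congr_right (htree b) _ _)).trans hb₂)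
    ((congrArg τ₂ (T₂.attach_congr_right (htree c) _ _)).trans hc₂) s
  change (⟨C₂.vertMap w, _⟩ : Σ w, T₂.Sphere w) = ⟨C₂.vertMap w, C₂.sphereMap w s⟩
  rw [key, Homeomorph.symm_apply_apply]

variable [Fintype Y] [Fintype Z] [DecidableEq Z] {d : ℕ}

/-- A cover with a given portrait is determined by its source and its target. -/
lemma TreeCover.HasPortrait.eq (hY : 3 ≤ Fintype.card Y) {P : Portrait Y Z d}
    {C₁ C₂ : TreeCover T T₁} (h₁ : C₁.HasPortrait P) (h₂ : C₂.HasPortrait P) : C₁ = C₂ := by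
  classical
  have := T.finite_vertices
  have := T₁.finite_vertices
  have := Fintype.ofFinite (Y ⊕ T.IV)
  obtain ⟨Φ₁, hΦ₁, hw₁⟩ := h₁.exists_harmonicMap hY
  obtain ⟨Φ₂, hΦ₂, hw₂⟩ := h₂.exists_harmonicMap hY
  have hv : C₁.vertMap = C₂.vertMap := hΦ₁.eq hΦ₂ T.isTree T₁.isTree T₁.stable
  have hl : C₁.leafMap = C₂.leafMap := h₁.1.trans h₂.1.symm
  refine TreeCover.eq_of_total_eq hl hv fun p => ?_
  obtain ⟨w, s⟩ := p
  have h3 : 2 < (T₁.graph.neighborSet (Sum.inr (C₁.vertMap w))).ncard := T₁.stable _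
  obtain ⟨a, b, c, ha, hb, hc, hab, hac, hbc⟩ := (Set.two_lt_ncard_iff (Set.toFinite _)).1 h3
  obtain ⟨τ, hτ, ha₁, hb₁, hc₁⟩ := exists_chart_zero_infty_one
    ((T₁.attach_injective _).ne (a₁ := ⟨a, ha⟩) (a₂ := ⟨b, hb⟩) (by simpa using hab))
    ((T₁.attach_injective _).ne (a₁ := ⟨a, ha⟩) (a₂ := ⟨c, hc⟩) (by simpa using hac))
    ((T₁.attach_injective _).ne (a₁ := ⟨b, hb⟩) (a₂ := ⟨c, hc⟩) (by simpa using hbc))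
  have hid : ∀ x : Z ⊕ T₁.IV, Sum.map id id x = x := fun x => by simp
  -- With one target, the same normalised chart serves both covers, and comparing charts becomes
  -- equality.
  have key := TreeCover.total_eq_of_charts (C₁ := C₁) (C₂ := C₂) (m := id) Function.injective_id
    (congrFun hv) hl (fun w a h => by
      have := (hΦ₁.branch_iff hΦ₂ T.isTree T₁.isTree T₁.isTree T₁.stable h).1
      rw [hw₁ w a h, hw₂ w a h] at this
      exact_mod_cast this)
    (w₁ := C₁.vertMap w) rfl ha hb hc (by rw [hid]; exact ha) (by rw [hid]; exact hb)
    (by rw [hid]; exact hc) hτ hτ ha₁ hb₁ hc₁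
    ((congrArg τ (T₁.attach_congr_right (hid a) _ _)).trans ha₁)
    ((congrArg τ (T₁.attach_congr_right (hid b) _ _)).trans hb₁)
    ((congrArg τ (T₁.attach_congr_right (hid c) _ _)).trans hc₁) ⟨w, s⟩ (C₁.sphereMap w s) rfl
  rw [Homeomorph.symm_apply_apply] at key
  exact key

/-- Covers with the same source and the same portrait differ by an isomorphism of the targets. -/
lemma TreeCover.HasPortrait.exists_treeEquiv (hY : 3 ≤ Fintype.card Y) {P : Portrait Y Z d}
    {C₁ : TreeCover T T₁} {C₂ : TreeCover T T₂} (h₁ : C₁.HasPortrait P) (h₂ : C₂.HasPortrait P) :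
    ∃ E : TreeEquiv T₁ T₂, E.vert ∘ C₁.vertMap = C₂.vertMap ∧
      E.toCover.total ∘ C₁.total = C₂.total := by
  classical
  have := T.finite_vertices
  have := T₁.finite_vertices
  have := T₂.finite_vertices
  have := Fintype.ofFinite (Y ⊕ T.IV)
  obtain ⟨Φ₁, hΦ₁, hw₁⟩ := h₁.exists_harmonicMap hY
  obtain ⟨Φ₂, hΦ₂, hw₂⟩ := h₂.exists_harmonicMap hY
  have hl : C₁.leafMap = C₂.leafMap := h₁.1.trans h₂.1.symm
  have ht₁ : Φ₁.toFun = C₁.treeMap := by rw [hΦ₁.map_eq, TreeCover.treeMap, h₁.1]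
  have ht₂ : Φ₂.toFun = C₂.treeMap := by rw [hΦ₂.map_eq, TreeCover.treeMap, h₂.1]
  have : Nonempty (Y ⊕ T.IV) := T.isTree.connected.nonempty
  have hs₁ : Function.Surjective C₁.treeMap := ht₁ ▸ Φ₁.surjective T₁.isTree.connected
  have hs₂ : Function.Surjective C₂.treeMap := ht₂ ▸ Φ₂.surjective T₂.isTree.connected
  -- The vertex maps are onto and have the same fibres, so going up by a section of one and down by
  -- the other gives a bijection between the internal vertices of the targets.
  choose r₁ hr₁ using (Sum.map_surjective.1 hs₁).2
  choose r₂ hr₂ using (Sum.map_surjective.1 hs₂).2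
  have hm₁ : ∀ w, C₂.vertMap (r₁ (C₁.vertMap w)) = C₂.vertMap w := fun w =>
    hΦ₁.inr_eq_of_inr_eq hΦ₂ T.isTree T₁.isTree T₂.isTree T₁.stable T₂.stable (hr₁ _)
  have hm₂ : ∀ w, C₁.vertMap (r₂ (C₂.vertMap w)) = C₁.vertMap w := fun w =>
    hΦ₂.inr_eq_of_inr_eq hΦ₁ T.isTree T₂.isTree T₁.isTree T₂.stable T₁.stable (hr₂ _)
  let m : T₁.IV ≃ T₂.IV :=
    ⟨C₂.vertMap ∘ r₁, C₁.vertMap ∘ r₂, fun w => by simp [hm₂, hr₁], fun w => by simp [hm₁, hr₂]⟩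
  have hmv : ∀ w, m (C₁.vertMap w) = C₂.vertMap w := hm₁
  have htree : ∀ a, C₂.treeMap a = Sum.map id m (C₁.treeMap a) := by
    intro a
    cases a with
    | inl y => simp [hl]
    | inr v => simp [hmv]
  have hinj : Function.Injective (Sum.map id m : Z ⊕ T₁.IV → Z ⊕ T₂.IV) :=
    Sum.map_injective.2 ⟨Function.injective_id, m.injective⟩
  have hadj : ∀ {a b : Z ⊕ T₁.IV}, T₂.graph.Adj (Sum.map id m a) (Sum.map id m b) ↔
      T₁.graph.Adj a b := by
    intro a b
    obtain ⟨x, rfl⟩ := hs₁ a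
    constructor
    · intro h
      rw [← htree, ← ht₂] at h
      obtain ⟨y, hxy, hy⟩ := Φ₂.exists_adj h
      rw [ht₂, htree] at hy
      rw [← hinj hy]
      exact C₁.map_adj hxy
    · intro h
      rw [← ht₁] at h
      obtain ⟨y, hxy, rfl⟩ := Φ₁.exists_adj h
      rw [ht₁, ← htree, ← htree]
      exact C₂.map_adj hxy
  have hdeg : ∀ (w : T.IV) (a : Y ⊕ T.IV) (h : T.graph.Adj (Sum.inr w) a),
      localDegree (C₁.sphereMap w) (T.attach w ⟨a, h⟩) =
        localDegree (C₂.sphereMap w) (T.attach w ⟨a, h⟩) := by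
    intro w a h
    have := (hΦ₁.branch_iff hΦ₂ T.isTree T₁.isTree T₂.isTree T₁.stable h).1
    rw [hw₁ w a h, hw₂ w a h] at this
    exact_mod_cast this
  have hsphere : ∀ w, ∃ μ : T₁.Sphere w ≃ₜ T₂.Sphere (m w), IsProjective μ ∧
      ∀ (p : Σ w, T.Sphere w) (x : T₁.Sphere w), ⟨w, x⟩ = C₁.total p →
        (⟨m w, μ x⟩ : Σ w, T₂.Sphere w) = C₂.total p := by
    intro w
    have h3 : 2 < (T₁.graph.neighborSet (Sum.inr w)).ncard := T₁.stable _
    obtain ⟨a, b, c, ha, hb, hc, hab, hac, hbc⟩ := (Set.two_lt_ncard_iff (Set.toFinite _)).1 h3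
    obtain ⟨τ₁, hτ₁, ha₁, hb₁, hc₁⟩ := exists_chart_zero_infty_one
      ((T₁.attach_injective _).ne (a₁ := ⟨a, ha⟩) (a₂ := ⟨b, hb⟩) (by simpa using hab))
      ((T₁.attach_injective _).ne (a₁ := ⟨a, ha⟩) (a₂ := ⟨c, hc⟩) (by simpa using hac))
      ((T₁.attach_injective _).ne (a₁ := ⟨b, hb⟩) (a₂ := ⟨c, hc⟩) (by simpa using hbc))
    have hadj' : ∀ {x}, T₁.graph.Adj (Sum.inr w) x →
        T₂.graph.Adj (Sum.inr (m w)) (Sum.map id m x) := fun h => hadj.2 h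
    obtain ⟨τ₂, hτ₂, ha₂, hb₂, hc₂⟩ := exists_chart_zero_infty_one
      (p := T₂.attach (m w) ⟨_, hadj' ha⟩) (q := T₂.attach (m w) ⟨_, hadj' hb⟩)
      (r := T₂.attach (m w) ⟨_, hadj' hc⟩) (fun h => hab (hinj (T₂.attach_inj.1 h)))
      (fun h => hac (hinj (T₂.attach_inj.1 h))) (fun h => hbc (hinj (T₂.attach_inj.1 h)))
    exact ⟨τ₁.trans τ₂.symm, isProjective_trans_symm hτ₁ hτ₂, fun p x hx =>
      TreeCover.total_eq_of_charts m.injective hmv hl hdeg rfl ha hb hc (hadj' ha) (hadj' hb)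
        (hadj' hc) hτ₁ hτ₂ ha₁ hb₁ hc₁ ha₂ hb₂ hc₂ p x hx⟩
  choose μ hμ hμ' using hsphere
  refine ⟨⟨m, hadj, μ, hμ, fun w a h => ?_⟩, funext hmv,
    funext fun p => hμ' _ p (C₁.sphereMap p.1 p.2) rfl⟩
  -- Each attaching point of the first target is the image of an attaching point of the source,
  -- whose image under the second cover is known.
  have hr : T₁.graph.Adj (Sum.inr (C₁.vertMap (r₁ w))) a := by rwa [hr₁]
  obtain ⟨b, hb, hba⟩ := C₁.exists_adj_of_adj hr
  have e₁ : (⟨w, T₁.attach w ⟨a, h⟩⟩ : Σ w, T₁.Sphere w) =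
      C₁.total ⟨r₁ w, T.attach _ ⟨b, hb⟩⟩ :=
    (T₁.attach_congr (hr₁ w).symm hba.symm h (C₁.map_adj hb)).trans
      (congrArg (Sigma.mk _) (C₁.sphereMap_attach _ _ hb).symm)
  have e₂ : C₂.total ⟨r₁ w, T.attach _ ⟨b, hb⟩⟩ =
      (⟨m w, T₂.attach (m w) ⟨Sum.map id m a, hadj.2 h⟩⟩ : Σ w, T₂.Sphere w) :=
    (congrArg (Sigma.mk _) (C₂.sphereMap_attach _ _ hb)).trans
      (T₂.attach_congr rfl (by rw [← hba]; exact htree b) (C₂.map_adj hb) (hadj.2 h))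
  exact eq_of_heq (Sigma.mk.inj ((hμ' w _ _ e₁).trans e₂)).2

/-- Covers with the same portrait and isomorphic sources are isomorphic. -/
lemma coverIso_of_treeIso (hY : 3 ≤ Fintype.card Y) {P : Portrait Y Z d}
    {C₁ C₂ : RevBar.{u, u', v} P} (h : TreeIso C₁.source C₂.source) : CoverIso C₁ C₂ := by
  obtain ⟨E⟩ := (treeIso_iff_nonempty hY _ _).1 h
  -- Pulling the second cover back along `E` gives both covers the same source without changing the
  -- portrait.
  have hC : (E.comp C₂.cover).HasPortrait P := by
    refine ⟨C₂.hasPortrait.1, fun y w h => ?_⟩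
    change localDegree (C₂.cover.sphereMap (E.vert w) ∘ E.sphere w) _ = _
    rw [localDegree_comp_projective _ (E.projective w), E.sphere_attach]
    exact C₂.hasPortrait.2 y (E.vert w) (E.adj_iff.2 h)
  obtain ⟨E', hv, ht⟩ := C₁.hasPortrait.exists_treeEquiv hY hC
  exact ⟨E.toCover, E'.toCover, E.toCover_isIso, E'.toCover_isIso,
    C₁.hasPortrait.1.trans C₂.hasPortrait.1.symm, hv, ht⟩

end Rigidity

end SphereTrees

theorem mainTheorem6 {Y : Type u} {Z : Type u'} [Fintype Y] [Fintype Z] [DecidableEq Z]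
    (hY : 3 ≤ Fintype.card Y) (hZ : 3 ≤ Fintype.card Z) {d : ℕ}
    (P : SphereTrees.Portrait Y Z d) :
    Function.Injective (SphereTrees.endTrees.{u, u', v} P) ∧
    Function.Injective (SphereTrees.endClasses.{u, u', v} P) ∧
    (∀ C₁ C₂ : SphereTrees.RevBar.{u, u', v} P,
      SphereTrees.TreeIso C₁.source C₂.source → SphereTrees.CoverIso C₁ C₂) ∧
    Function.Injective (SphereTrees.sourceClass.{u, u', v} P) := by
  have hsource : Function.Injective (SphereTrees.sourceClass.{u, u', v} P) := by
    rintro ⟨C₁⟩ ⟨C₂⟩ h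
    -- Equality in a `Quot` yields only the generated equivalence; `TreeIso` is already one, so it
    -- returns an isomorphism of the sources.
    exact Quot.sound (SphereTrees.coverIso_of_treeIso hY
      ((SphereTrees.treeIso_equivalence hY).quot_mk_eq_iff _ _ |>.1 h))
  refine ⟨?_, fun c₁ c₂ h => hsource (congrArg Prod.fst h),
    fun C₁ C₂ h => SphereTrees.coverIso_of_treeIso hY h, hsource⟩
  rintro ⟨S₁, T₁, C₁, h₁⟩ ⟨S₂, T₂, C₂, h₂⟩ h
  obtain ⟨hS, hT⟩ := Prod.mk.inj h
  obtain rfl : S₁ = S₂ := hS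
  obtain rfl : T₁ = T₂ := hT
  obtain rfl : C₁ = C₂ := h₁.eq hY h₂
  rfl
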